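/- Let $b_1,b_2>0$, $0<x_2<1$, and let $k\ge 1$ be an integer. Let $a_k:\mathbb R\to(0,\infty)$ be given by $a_k(x)=b_2^{-2}$ if $x\in[j,j+x_2)$ for some $j\in\{0,\dots,k-1\}$, and $a_k(x)=b_1^{-2}$ otherwise. Let $P_k=-\partial_x a_k\partial_x$ on $L^2(\mathbb R)$ with domain $\{u\in H^1(\mathbb R): a_k u'\in H^1(\mathbb R)\}$. Put $\mathbb C_\pm=\{\lambda\in\mathbb C:\pm\operatorname{Im}\lambda>0\}$. The resolvent $(P_k-\lambda^2)^{-1}$, $\lambda\in\mathbb C_+$, extends meromorphically to $\lambda\in\mathbb C$ as a family of operators $L^2_{\rm comp}(\mathbb R)\to L^2_{\rm loc}(\mathbb R)$ (that is, for every $N$ the operator-valued function $1_{[-N,N]}(P_k-\lambda^2)^{-1}1_{[-N,N]}$ extends meromorphically to $\mathbb C$); its poles in $\mathbb C_-$ (the poles of these extensions, for some $N$) are the resonances of $P_k$, and ${\rm Res}(P_k)$ denotes the set of them. For $\lambda\neq0$, $\operatorname{Im}\lambda\ge0$, the reflection coefficient $r_k(\lambda)$ is the unique $r\in\mathbb C$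 for which there are $t\in\mathbb C$ and a solution $\psi$ (with $\psi,a_k\psi'\in H^1_{\rm loc}(\mathbb R)$) of $-(a_k\psi')'=\lambda^2\psi$ such that $\psi(x)=e^{i\lambda b_1x}+r\,e^{-i\lambda b_1x}$ for $x<0$ and $\psi(x)=t\,e^{i\lambda b_1x}$ for $x>k$. For $m\ge1$ let $\beta_m=b_1$ if $m$ is odd and $\beta_m=b_2$ if $m$ is even, and let $\xi_{2j+1}=j$, $\xi_{2j}=j-1+x_2$. Define $\det D_n=\det D_n(-i\lambda)$ and $\det\widetilde D_n=\det\widetilde D_n(-i\lambda)$ by $\det D_2=(\beta_1+\beta_2)e^{i\lambda\xi_1(\beta_2-\beta_1)}$, $\det\widetilde D_2=(\beta_2-\beta_1)e^{-i\lambda\xi_1(\beta_1+\beta_2)}$ and, for $n\ge3$, $$\det D_n=e^{i\lambda \beta_n\xi_{n-1}}\big[(\beta_{n-1}-\beta_n)e^{i\lambda \beta_{n-1}\xi_{n-1}}\det\widetilde D_{n-1}-(\beta_{n-1}+\beta_n)e^{-i\lambda \beta_{n-1}\xi_{n-1}}\det D_{n-1}\big],$$ $$\det\widetilde D_n=e^{-i\lambda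 \beta_n\xi_{n-1}}\big[(\beta_{n-1}-\beta_n)e^{-i\lambda \beta_{n-1}\xi_{n-1}}\det D_{n-1}-(\beta_{n-1}+\beta_n)e^{i\lambda \beta_{n-1}\xi_{n-1}}\det\widetilde D_{n-1}\big].$$ Let $Q_m(-i\lambda)=e^{2i\lambda \beta_m\xi_m}\,\det\widetilde D_m/\det D_m$ and $d=(b_2-b_1)/(b_2+b_1)$. Then $r_k$ is well defined for $\lambda\ne 0$, $\operatorname{Im}\lambda\ge0$, and extends to a meromorphic function on $\mathbb C$ that is analytic on $\{\operatorname{Im}\lambda\ge0\}$ and on $\mathbb C_-\setminus{\rm Res}(P_k)$, and whose poles in $\mathbb C_-$ are exactly the points of ${\rm Res}(P_k)$. Moreover, for $\lambda\in\mathbb C_-$, $$\lambda\in{\rm Res}(P_k)\iff\det D_{2k+1}(-i\lambda)=0,$$ and, if $b_1\neq b_2$, this is also equivalent to $\det D_{2k}(-i\lambda)\ne0$ and $Q_{2k}(-i\lambda)=1/d$. Finally $$r_k(\lambda)=-\frac{-d+Q_{2k}(-i\lambda)}{1-d\,Q_{2k}(-i\lambda)}$$ for every $\lambda\in\mathbb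 C$ with $\det D_{2k}(-i\lambda)\neq0$ and $1-d\,Q_{2k}(-i\lambda)\neq0$. -/

import Mathlib

noncomputable section

namespace FinitePeriodic

open MeasureTheory Complex

open scoped ContDiff

/-- The complex Hilbert space `L²(ℝ)`. -/
abbrev L2 : Type := Lp ℂ 2 (volume : Measure ℝ)

/-- `g` is the weak (distributional) derivative of `f` on the real line. -/
def HasWeakDeriv (f g : ℝ → ℂ) : Prop :=
  LocallyIntegrable f ∧ LocallyIntegrable g ∧
    ∀ φ : ℝ → ℝ, ContDiff ℝ ∞ φ → HasCompactSupport φ →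
      ∫ x, deriv φ x • f x = -∫ x, φ x • g x

/-- `f ∈ L²_loc(ℝ)`. -/
def MemL2Loc (f : ℝ → ℂ) : Prop :=
  ∀ K : Set ℝ, IsCompact K → MemLp f 2 (volume.restrict K)

/-- `f ∈ H¹_loc(ℝ)` with weak derivative `g`. -/
def HasH1LocDeriv (f g : ℝ → ℂ) : Prop :=
  MemL2Loc f ∧ MemL2Loc g ∧ HasWeakDeriv f g

/-! ### The operator `P_k = -∂ₓ a_k ∂ₓ` -/

/-- The unit cell: `b₂⁻²` on `[0, x₂)` and `b₁⁻²` on `[x₂, 1)`. -/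
def unitCell (b₁ b₂ x₂ : ℝ) (y : ℝ) : ℝ :=
  if y < x₂ then (b₂ ^ 2)⁻¹ else (b₁ ^ 2)⁻¹

/-- The coefficient `a_k`: `k` copies of the unit cell on `[0, k)`, and `b₁⁻²` elsewhere. -/
def coeff (b₁ b₂ x₂ : ℝ) (k : ℕ) (x : ℝ) : ℝ :=
  if 0 ≤ x ∧ x < k then unitCell b₁ b₂ x₂ (Int.fract x) else (b₁ ^ 2)⁻¹

/-- The graph of `P_k`: `u ∈ H¹(ℝ)`, `a_k u' ∈ H¹(ℝ)` and `P_k u = -(a_k u')' = f`.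
Membership of `a_k u'` in `L²` is automatic since `a_k` is bounded. -/
def OperatorGraph (b₁ b₂ x₂ : ℝ) (k : ℕ) (u f : L2) : Prop :=
  ∃ w : L2, HasWeakDeriv u w ∧
    HasWeakDeriv (fun x => (coeff b₁ b₂ x₂ k x : ℂ) * w x) (fun x => -f x)

/-- `R = (P_k - z²)⁻¹` as a bounded operator on `L²(ℝ)`: for every `v`, the vector `R v` is the
unique `u` in the domain of `P_k` with `P_k u = z² u + v`. -/
def IsResolventAt (b₁ b₂ x₂ : ℝ) (k : ℕ) (z : ℂ) (R : L2 →L[ℂ] L2) : Prop :=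
  ∀ u v : L2, R v = u ↔ OperatorGraph b₁ b₂ x₂ k u (z ^ 2 • u + v)

/-- The class of `1_{[-N,N]} u` in `L²(ℝ)`. -/
def cutoffFun (N : ℝ) (u : L2) : L2 :=
  ((Lp.memLp u).indicator (measurableSet_Icc (a := -N) (b := N))).toLp _

theorem cutoffFun_coeFn (N : ℝ) (u : L2) :
    ∀ᵐ x : ℝ, cutoffFun N u x = (Set.Icc (-N) N).indicator (fun y => u y) x :=
  MemLp.coeFn_toLp _

theorem cutoffFun_add (N : ℝ) (u v : L2) :
    cutoffFun N (u + v) = cutoffFun N u + cutoffFun N v := by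
  apply Lp.ext
  filter_upwards [cutoffFun_coeFn N (u + v), cutoffFun_coeFn N u, cutoffFun_coeFn N v,
    Lp.coeFn_add u v, Lp.coeFn_add (cutoffFun N u) (cutoffFun N v)] with x h1 h2 h3 h4 h5
  rw [h1, h5, Pi.add_apply, h2, h3]
  by_cases hx : x ∈ Set.Icc (-N) N
  · rw [Set.indicator_of_mem hx, Set.indicator_of_mem hx, Set.indicator_of_mem hx, h4,
      Pi.add_apply]
  · rw [Set.indicator_of_notMem hx, Set.indicator_of_notMem hx, Set.indicator_of_notMem hx,
      add_zero]

theorem cutoffFun_smul (N : ℝ) (c : ℂ) (u : L2) :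
    cutoffFun N (c • u) = c • cutoffFun N u := by
  apply Lp.ext
  filter_upwards [cutoffFun_coeFn N (c • u), cutoffFun_coeFn N u,
    Lp.coeFn_smul c u, Lp.coeFn_smul c (cutoffFun N u)] with x h1 h2 h3 h4
  rw [h1, h4, Pi.smul_apply, h2]
  by_cases hx : x ∈ Set.Icc (-N) N
  · rw [Set.indicator_of_mem hx, Set.indicator_of_mem hx, h3, Pi.smul_apply]
  · rw [Set.indicator_of_notMem hx, Set.indicator_of_notMem hx, smul_zero]

theorem norm_cutoffFun_le (N : ℝ) (u : L2) : ‖cutoffFun N u‖ ≤ 1 * ‖u‖ := by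
  rw [one_mul]
  apply Lp.norm_le_norm_of_ae_le
  filter_upwards [cutoffFun_coeFn N u] with x hx
  rw [hx]
  exact norm_indicator_le_norm_self _ _

/-- Multiplication by the indicator function of `[-N, N]` as a bounded operator on `L²(ℝ)`. -/
def cutoff (N : ℝ) : L2 →L[ℂ] L2 :=
  LinearMap.mkContinuous
    { toFun := cutoffFun N
      map_add' := cutoffFun_add N
      map_smul' := cutoffFun_smul N }
    1 (norm_cutoffFun_le N)

/-- `A` is the meromorphic continuation to `ℂ` of the cut-off resolvent
`1_{[-N,N]} (P_k - z²)⁻¹ 1_{[-N,N]}`, `Im z > 0`, as a function with values in the bounded operators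
on `L²(ℝ)`. The continuation of the resolvent as a family of operators from `L²_comp` to `L²_loc`
is the collection of these continuations for all `N`. -/
def IsCutoffResolventContinuation (b₁ b₂ x₂ : ℝ) (k : ℕ) (N : ℝ) (A : ℂ → L2 →L[ℂ] L2) : Prop :=
  MeromorphicOn A Set.univ ∧
    ∀ z : ℂ, 0 < z.im → ∃ R : L2 →L[ℂ] L2, IsResolventAt b₁ b₂ x₂ k z R ∧
      A z = (cutoff N).comp (R.comp (cutoff N))

/-- `Res(P_k)`: the poles in the open lower half-plane of the meromorphic continuation of the
resolvent `(P_k - z²)⁻¹ : L²_comp → L²_loc`. -/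
def resonances (b₁ b₂ x₂ : ℝ) (k : ℕ) : Set ℂ :=
  {z | z.im < 0 ∧ ∃ (N : ℝ) (A : ℂ → L2 →L[ℂ] L2),
    IsCutoffResolventContinuation b₁ b₂ x₂ k N A ∧ meromorphicOrderAt A z < 0}

/-! ### The reflection coefficient -/

/-- `ρ` is a reflection coefficient of `P_k` at frequency `z`: some solution
`ψ ∈ H¹_loc`, `a_k ψ' ∈ H¹_loc` of `P_k ψ = z² ψ` equals `e^{i z b₁ x} + ρ e^{-i z b₁ x}` for `x < 0`
and `τ e^{i z b₁ x}` for `x > k`. -/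
def IsReflectionCoefficient (b₁ b₂ x₂ : ℝ) (k : ℕ) (z ρ : ℂ) : Prop :=
  ∃ (ψ w : ℝ → ℂ) (τ : ℂ),
    HasH1LocDeriv ψ w ∧
    HasH1LocDeriv (fun x => (coeff b₁ b₂ x₂ k x : ℂ) * w x) (fun x => -(z ^ 2 * ψ x)) ∧
    (∀ x : ℝ, x < 0 → ψ x = exp (I * z * b₁ * x) + ρ * exp (-(I * z * b₁ * x))) ∧
    (∀ x : ℝ, (k : ℝ) < x → ψ x = τ * exp (I * z * b₁ * x))

/-! ### The determinants `det D_n`, `det D̃_n` and the functions `Q_m` -/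

/-- The pair `(det D_n(s), det D̃_n(s))` attached to a step function with values `b_j⁻²` on
`(x_{j-1}, x_j)`, given by the recursion in `n ≥ 2`; here `s = -iλ`. The values at `n = 0, 1` are
irrelevant. -/
def detPair (b x : ℕ → ℝ) (s : ℂ) : ℕ → ℂ × ℂ
  | 0 => 0
  | 1 => 0
  | 2 => ((b 1 + b 2) * exp (-s * x 1 * (b 2 - b 1)),
      (b 2 - b 1) * exp (s * x 1 * (b 1 + b 2)))
  | (m + 3) =>
    let D := (detPair b x s (m + 2)).1
    let D' := (detPair b x s (m + 2)).2
    (exp (-s * b (m + 3) * x (m + 2)) *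
        ((b (m + 2) - b (m + 3)) * exp (-s * b (m + 2) * x (m + 2)) * D' -
          (b (m + 2) + b (m + 3)) * exp (s * b (m + 2) * x (m + 2)) * D),
      exp (s * b (m + 3) * x (m + 2)) *
        ((b (m + 2) - b (m + 3)) * exp (s * b (m + 2) * x (m + 2)) * D -
          (b (m + 2) + b (m + 3)) * exp (-s * b (m + 2) * x (m + 2)) * D'))

/-- `b₁ = b₃ = b₅ = …` and `b₂ = b₄ = …`. -/
def layerB (b₁ b₂ : ℝ) (m : ℕ) : ℝ := if Odd m then b₁ else b₂

/-- The interfaces `x_{2j+1} = j` and `x_{2j} = j - 1 + x₂`. -/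
def layerX (x₂ : ℝ) (m : ℕ) : ℝ := if Odd m then ((m : ℝ) - 1) / 2 else (m : ℝ) / 2 - 1 + x₂

/-- `det D_n(s)` for the finite periodic medium. -/
def detD (b₁ b₂ x₂ : ℝ) (n : ℕ) (s : ℂ) : ℂ :=
  (detPair (layerB b₁ b₂) (layerX x₂) s n).1

/-- `det D̃_n(s)` for the finite periodic medium. -/
def detDtilde (b₁ b₂ x₂ : ℝ) (n : ℕ) (s : ℂ) : ℂ :=
  (detPair (layerB b₁ b₂) (layerX x₂) s n).2

/-- `Q_m(s) = e^{-2 s b_m x_m} det D̃_m(s) / det D_m(s)`; meaningful where `det D_m(s) ≠ 0`. -/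
def Q (b₁ b₂ x₂ : ℝ) (m : ℕ) (s : ℂ) : ℂ :=
  exp (-2 * s * layerB b₁ b₂ m * layerX x₂ m) *
    (detDtilde b₁ b₂ x₂ m s / detD b₁ b₂ x₂ m s)

/-- `d = (b₂ - b₁) / (b₂ + b₁)`. -/
def dCoeff (b₁ b₂ : ℝ) : ℝ := (b₂ - b₁) / (b₂ + b₁)

end FinitePeriodic

end

noncomputable section

namespace FinitePeriodic

open MeasureTheory Complex

open scoped ContDiff

/-! ### Primitives of locally integrable functions -/

/-! Put s = -iλ, so that Re s = Im λ and the equation reads (aψ')' = s²ψ. On a layer with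
coefficient b⁻² the solutions are spanned by e^{±sby}, and continuity of ψ and of the flux aψ' at
the interfaces is a 2×2 recursion for the two amplitudes. Applied to the left-outgoing solution
`jostL`, equal to e^{s b₁ y} for y < 0, it is the recursion of the determinants: in each layer
`jostL` is a nonzero real multiple of det D e^{sby} - det D̃ e^{-sby}. Write L = k - 1 + x₂. The
medium is symmetric about L/2, so y ↦ `jostL` (L - y) is the right-outgoing solution `jostR`. The
Wronskian W of the two is s det D_{2k+1} times a function without zeros.

For Re s ≥ 0 the growing amplitude strictly dominates the decaying one from layer to layer
(`norm_layerPair_lt`), so det D_{2k+1} ≠ 0. For Re s > 0 the resolvent is then the integral operator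
with kernel -W⁻¹ `jostR`(max(x,y)) `jostL`(min(x,y)) (`exists_resolvent`). Between cutoffs it is an
entire operator family divided by the scalar W, which is the meromorphic continuation. The entire
family vanishes at no s once the window contains the medium (`cutoff_green_ne_zero`), so the poles
in the lower half-plane are exactly the zeros of det D_{2k+1} (`mem_resonances_iff`).

A solution that is outgoing on the right is a multiple of `jostR`; its amplitudes on the left give r
= -e^{-2 s b₁ L} det D̃_{2k+1} / det D_{2k+1} (`isReflectionCoefficient_iff`). The two determinants
have no common zero because the matching matrices are invertible (`layerPair_ne_zero`), so nothing
cancels and the poles of r are again the zeros of det D_{2k+1}. The last step of the recursion makes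
det D_{2k+1} and det D̃_{2k+1} proportional to 1 - d Q_{2k} and d - Q_{2k} (`detD_eq_Q`), whence the
linear fractional formula and the condition Q_{2k} = 1/d.

The analytic groundwork replaces weak derivatives by integral primitives, builds operators on L² by
the Schur test, and obtains holomorphy from multipliers that are holomorphic with values in L^∞. -/

/-- `f` is a primitive of the locally integrable function `g`. -/
def IsPrimitive (f g : ℝ → ℂ) : Prop :=
  LocallyIntegrable g ∧ ∀ x, f x = f 0 + ∫ t in (0 : ℝ)..x, g t

theorem intervalIntegrable_of_locallyIntegrable {g : ℝ → ℂ} (hg : LocallyIntegrable g)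
    (a b : ℝ) : IntervalIntegrable g volume a b :=
  intervalIntegrable_iff.2
    ((hg.integrableOn_isCompact isCompact_uIcc).mono_set Set.uIoc_subset_uIcc)

namespace IsPrimitive

variable {f g F G : ℝ → ℂ}

theorem intervalIntegrable (h : IsPrimitive f g) (a b : ℝ) : IntervalIntegrable g volume a b :=
  intervalIntegrable_of_locallyIntegrable h.1 a b

theorem sub_eq (h : IsPrimitive f g) (a b : ℝ) : f b - f a = ∫ t in a..b, g t := by
  rw [h.2 b, h.2 a, add_sub_add_left_eq_sub,
    intervalIntegral.integral_interval_sub_left (h.intervalIntegrable _ _)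
      (h.intervalIntegrable _ _)]

theorem of_sub_eq (hg : LocallyIntegrable g) (c : ℝ)
    (h : ∀ x, f x = f c + ∫ t in c..x, g t) : IsPrimitive f g := by
  refine ⟨hg, fun x => ?_⟩
  rw [h x, h 0, add_assoc, intervalIntegral.integral_add_adjacent_intervals
    (intervalIntegrable_of_locallyIntegrable hg _ _)
    (intervalIntegrable_of_locallyIntegrable hg _ _)]

theorem continuous (h : IsPrimitive f g) : Continuous f := by
  have : f = fun x => f 0 + ∫ t in (0 : ℝ)..x, g t := funext h.2
  rw [this]
  exact continuous_const.add (intervalIntegral.continuous_primitive h.intervalIntegrable 0)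

theorem congr_ae (h : IsPrimitive f g) (hg : g =ᵐ[volume] G) : IsPrimitive f G := by
  refine ⟨h.1.congr hg, fun x => ?_⟩
  rw [h.2 x]
  congr 1
  exact intervalIntegral.integral_congr_ae (hg.mono fun x hx _ => hx)

theorem ae_hasDerivAt (h : IsPrimitive f g) : ∀ᵐ x, HasDerivAt f (g x) x := by
  filter_upwards [_root_.LocallyIntegrable.ae_hasDerivAt_integral h.1] with x hx
  have : f = fun x => f 0 + ∫ t in (0 : ℝ)..x, g t := funext h.2
  rw [this]
  exact (hx 0).const_add _

theorem of_hasDerivAt (hf : ∀ x, HasDerivAt f (g x) x) (hg : Continuous g) :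
    IsPrimitive f g := by
  refine ⟨hg.locallyIntegrable, fun x => ?_⟩
  rw [intervalIntegral.integral_eq_sub_of_hasDerivAt (fun x _ => hf x)
    (hg.intervalIntegrable _ _)]
  ring

theorem zero_eq (h : IsPrimitive f fun _ => 0) (x y : ℝ) : f x = f y := by
  rw [h.2 x, h.2 y]; simp

theorem add (h : IsPrimitive f g) (H : IsPrimitive F G) :
    IsPrimitive (fun x => f x + F x) (fun x => g x + G x) := by
  refine ⟨h.1.add H.1, fun x => ?_⟩
  beta_reduce
  rw [intervalIntegral.integral_add (h.intervalIntegrable _ _) (H.intervalIntegrable _ _),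
    sub_eq_iff_eq_add'.1 (h.sub_eq 0 x), sub_eq_iff_eq_add'.1 (H.sub_eq 0 x)]
  ring

theorem const_mul (c : ℂ) (h : IsPrimitive f g) :
    IsPrimitive (fun x => c * f x) (fun x => c * g x) := by
  refine ⟨h.1.smul c, fun x => ?_⟩
  beta_reduce
  rw [intervalIntegral.integral_const_mul, h.2 x]
  ring

theorem sub (h : IsPrimitive f g) (H : IsPrimitive F G) :
    IsPrimitive (fun x => f x - F x) (fun x => g x - G x) := by
  refine ⟨h.1.sub H.1, fun x => ?_⟩
  beta_reduce
  rw [intervalIntegral.integral_sub (h.intervalIntegrable _ _) (H.intervalIntegrable _ _),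
    sub_eq_iff_eq_add'.1 (h.sub_eq 0 x), sub_eq_iff_eq_add'.1 (H.sub_eq 0 x)]
  ring

theorem absolutelyContinuous (h : IsPrimitive f g) (a b : ℝ) :
    AbsolutelyContinuousOnInterval f a b := by
  have cst : ∀ c : ℂ, AbsolutelyContinuousOnInterval (fun _ : ℝ => c) a b := fun c =>
    (LipschitzWith.const c).lipschitzOnWith.absolutelyContinuousOnInterval
  have hre : IntervalIntegrable (fun x => (g x).re) volume a b :=
    ⟨(h.intervalIntegrable a b).1.re, (h.intervalIntegrable a b).2.re⟩
  have him : IntervalIntegrable (fun x => (g x).im) volume a b :=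
    ⟨(h.intervalIntegrable a b).1.im, (h.intervalIntegrable a b).2.im⟩
  -- The real and imaginary parts of `g` are integrated separately and recombined with the vectors 1
  -- and I.
  have h1 := (hre.absolutelyContinuousOnInterval_intervalIntegral
    (c := a) Set.left_mem_uIcc).fun_smul (cst 1)
  have h2 := (him.absolutelyContinuousOnInterval_intervalIntegral
    (c := a) Set.left_mem_uIcc).fun_smul (cst I)
  have h3 := (cst (f a)).fun_add (h1.fun_add h2)
  suffices e : f = fun x => f a + ((∫ v in a..x, (g v).re) • (1 : ℂ) +
      (∫ v in a..x, (g v).im) • I) by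
    rw [e]; exact h3
  funext x
  rw [← sub_eq_iff_eq_add', h.sub_eq a x, real_smul, real_smul, mul_one]
  have hre' : IntervalIntegrable (fun t => ((g t).re : ℂ)) volume a x :=
    ⟨(h.intervalIntegrable a x).1.re.ofReal, (h.intervalIntegrable a x).2.re.ofReal⟩
  have him' : IntervalIntegrable (fun t => ((g t).im : ℂ)) volume a x :=
    ⟨(h.intervalIntegrable a x).1.im.ofReal, (h.intervalIntegrable a x).2.im.ofReal⟩
  rw [← intervalIntegral.integral_ofReal, ← intervalIntegral.integral_ofReal,
    ← intervalIntegral.integral_mul_const, ← intervalIntegral.integral_add hre' (him'.mul_const I)]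
  simp only [re_add_im]

theorem locallyIntegrable_mul (h : Continuous f) (hg : LocallyIntegrable g) :
    LocallyIntegrable (fun x => f x * g x) := by
  have := hg.locallyIntegrableOn Set.univ
  rw [← locallyIntegrableOn_univ]
  exact this.continuousOn_mul h.continuousOn isOpen_univ.isLocallyClosed

/-- The product minus the integral of its formal derivative is absolutely continuous with derivative
zero almost everywhere, hence constant. -/
theorem mul (h : IsPrimitive f g) (H : IsPrimitive F G) :
    IsPrimitive (fun x => f x * F x) (fun x => f x * G x + F x * g x) := by
  have hl : LocallyIntegrable (fun x => f x * G x + F x * g x) :=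
    (locallyIntegrable_mul h.continuous H.1).add (locallyIntegrable_mul H.continuous h.1)
  have hP : IsPrimitive (fun x => ∫ t in (0 : ℝ)..x, (f t * G t + F t * g t))
      (fun x => f x * G x + F x * g x) := ⟨hl, fun x => by simp⟩
  refine ⟨hl, fun x => ?_⟩
  have hac := ((h.absolutelyContinuous 0 x).fun_smul (H.absolutelyContinuous 0 x)).fun_sub
    (hP.absolutelyContinuous 0 x)
  have hder : ∀ᵐ y, y ∈ Set.uIcc 0 x → HasDerivAt
      (fun y => f y • F y - ∫ t in (0 : ℝ)..y, (f t * G t + F t * g t)) 0 y := by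
    filter_upwards [h.ae_hasDerivAt, H.ae_hasDerivAt, hP.ae_hasDerivAt] with y h1 h2 h3 _
    exact ((h1.mul h2).sub h3).congr_deriv (by ring)
  obtain ⟨C, hC⟩ := hac.const_of_ae_hasDerivAt_zero hder
  have e1 := hC 0 Set.left_mem_uIcc
  have e2 := hC x Set.right_mem_uIcc
  simp only [smul_eq_mul, intervalIntegral.integral_same, sub_zero] at e1 e2
  beta_reduce
  rw [e1, ← e2]; ring

/-- Gluing of primitives which agree at a point. -/
theorem glue (h : IsPrimitive f g) (H : IsPrimitive F G) (c : ℝ) (hc : f c = F c) :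
    IsPrimitive (fun x => if x < c then f x else F x) (fun x => if x < c then g x else G x) := by
  have hl : LocallyIntegrable (fun x => if x < c then g x else G x) := by
    intro x
    obtain ⟨s, hs, hgs⟩ := h.1 x
    obtain ⟨t, ht, hGt⟩ := H.1 x
    refine ⟨s ∩ t, Filter.inter_mem hs ht, ?_⟩
    have e : (fun x => if x < c then g x else G x) =
        fun x => (Set.Iio c).indicator g x + (Set.Iio c)ᶜ.indicator G x := by
      funext x
      by_cases hx : x < c
      · simp [hx]
      · simp [hx, Set.indicator_of_mem (show x ∈ Set.Ici c from not_lt.1 hx)]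
    rw [e]
    exact ((hgs.mono_set Set.inter_subset_left).indicator measurableSet_Iio).add
      ((hGt.mono_set Set.inter_subset_right).indicator measurableSet_Iio.compl)
  refine of_sub_eq hl c fun x => ?_
  by_cases hx : x < c
  · simp only [hx, if_true, lt_irrefl, if_false]
    rw [← hc, ← sub_eq_iff_eq_add', h.sub_eq c x]
    -- At `c` itself the glued derivative takes the value from the right; this is one point, of
    -- measure zero.
    have : ∀ᵐ y : ℝ, y ≠ c := by simp [ae_iff, measure_singleton]
    refine intervalIntegral.integral_congr_ae ?_
    filter_upwards [this] with y hy hy'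
    rw [Set.uIoc_of_ge hx.le] at hy'
    rw [if_pos (lt_of_le_of_ne hy'.2 hy)]
  · simp only [hx, if_false, lt_irrefl]
    rw [← sub_eq_iff_eq_add', H.sub_eq c x]
    refine intervalIntegral.integral_congr_ae (Filter.Eventually.of_forall fun y hy' => ?_)
    rw [Set.uIoc_of_le (not_lt.1 hx)] at hy'
    simp only [not_lt.2 hy'.1.le, if_false]

theorem comp_sub_left (h : IsPrimitive f g) (L : ℝ) :
    IsPrimitive (fun x => f (L - x)) (fun x => -g (L - x)) := by
  refine ⟨?_, fun x => ?_⟩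
  · have : LocallyIntegrable (fun x => g (L - x)) := by
      rw [MeasureTheory.locallyIntegrable_iff]
      intro K hK
      have hK' : IsCompact (Set.image (fun x => L - x) K) := hK.image (by fun_prop)
      have := (MeasureTheory.locallyIntegrable_iff.1 h.1) _ hK'
      have hmp : MeasurePreserving (fun x : ℝ => L - x) volume volume :=
        volume.measurePreserving_sub_left L
      exact (hmp.integrableOn_image (MeasurableEquiv.subLeft L).measurableEmbedding).1 this
    exact this.neg
  · rw [intervalIntegral.integral_neg, intervalIntegral.integral_comp_sub_left (fun y => g y) L]
    simp only [sub_zero]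
    rw [← h.sub_eq (L - x) L]; ring

/-- Integrate the product rule for φ f over an interval at whose ends the test function vanishes. -/
theorem hasWeakDeriv (h : IsPrimitive f g) : HasWeakDeriv f g := by
  refine ⟨h.continuous.locallyIntegrable, h.1, fun φ hφ hc => ?_⟩
  have hφ' : Continuous (deriv φ) := hφ.continuous_deriv (by simp)
  have hφP : IsPrimitive (fun x => (φ x : ℂ)) (fun x => ((deriv φ x : ℝ) : ℂ)) :=
    of_hasDerivAt (g := fun x => ((deriv φ x : ℝ) : ℂ))
      (fun x => ((hφ.differentiable (by simp)) x).hasDerivAt.ofReal_comp) (by fun_prop)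
  have hm := hφP.mul h
  obtain ⟨M, hM0, hM⟩ : ∃ M : ℝ, 0 < M ∧ ∀ x, M ≤ |x| → φ x = 0 ∧ deriv φ x = 0 := by
    obtain ⟨R, hR⟩ := hc.isCompact.isBounded.subset_closedBall 0
    -- The extra 1 puts the endpoints ±M themselves outside the support, so the boundary terms
    -- vanish.
    refine ⟨max R 0 + 1, by positivity, fun x hx => ?_⟩
    have hx' : x ∉ tsupport φ := fun hxs => by
      have := hR hxs
      rw [Metric.mem_closedBall, Real.dist_eq, sub_zero] at this
      linarith [le_max_left R 0]
    exact ⟨image_eq_zero_of_notMem_tsupport hx',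
      image_eq_zero_of_notMem_tsupport fun hd => hx' (tsupport_deriv_subset hd)⟩
  have key := hm.sub_eq (-M) M
  rw [(hM M (le_abs_self M)).1, (hM (-M) (by rw [abs_neg]; exact le_abs_self M)).1] at key
  have i1 : Integrable (fun x => deriv φ x • f x) := by
    apply Continuous.integrable_of_hasCompactSupport
    · exact hφ'.smul h.continuous
    · exact hc.deriv.smul_right
  have i2 : Integrable (fun x => φ x • g x) :=
    h.1.integrable_smul_left_of_hasCompactSupport hφ.continuous hc
  rw [eq_neg_iff_add_eq_zero, ← integral_add i1 i2]
  rw [intervalIntegral.integral_of_le (by linarith)] at key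
  rw [← setIntegral_eq_integral_of_forall_compl_eq_zero (s := Set.Ioc (-M) M)]
  · rw [show (0 : ℂ) = ((0 : ℝ) : ℂ) * f M - ((0 : ℝ) : ℂ) * f (-M) by simp, key]
    congr 1
    funext x
    simp only [real_smul]; ring
  · intro x hx
    have : M ≤ |x| := by
      by_contra hlt
      exact hx ⟨(abs_lt.1 (not_le.1 hlt)).1, (abs_lt.1 (not_le.1 hlt)).2.le⟩
    simp [hM x this]

end IsPrimitive

/-! ### Weak derivatives -/

theorem HasWeakDeriv.congr_ae {f g F G : ℝ → ℂ} (h : HasWeakDeriv f g) (hf : f =ᵐ[volume] F)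
    (hg : g =ᵐ[volume] G) : HasWeakDeriv F G := by
  refine ⟨h.1.congr hf, h.2.1.congr hg, fun φ hφ hc => ?_⟩
  have e1 : ∫ x, deriv φ x • F x = ∫ x, deriv φ x • f x :=
    integral_congr_ae (hf.mono fun x hx => by simp [hx])
  have e2 : ∫ x, φ x • G x = ∫ x, φ x • g x :=
    integral_congr_ae (hg.mono fun x hx => by simp [hx])
  rw [e1, e2, h.2.2 φ hφ hc]

/-- A smooth compactly supported function with vanishing integral has a smooth compactly supported
primitive. -/
theorem exists_contDiff_primitive {φ : ℝ → ℝ} (hφ : ContDiff ℝ ∞ φ) (hc : HasCompactSupport φ)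
    (h0 : ∫ x, φ x = 0) :
    ∃ Φ : ℝ → ℝ, ContDiff ℝ ∞ Φ ∧ HasCompactSupport Φ ∧ deriv Φ = φ := by
  obtain ⟨R, hR⟩ := hc.isCompact.isBounded.subset_closedBall 0
  have hz : ∀ x, x ∉ Set.Icc (-R) R → φ x = 0 := fun x hx =>
    image_eq_zero_of_notMem_tsupport fun hxs => hx <| by
      have := hR hxs
      rw [Metric.mem_closedBall, Real.dist_eq, sub_zero] at this
      exact abs_le.1 this
  have hd : ∀ x, HasDerivAt (fun x => ∫ t in (-R)..x, φ t) (φ x) x := fun x =>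
    intervalIntegral.integral_hasDerivAt_right (hφ.continuous.intervalIntegrable _ _)
      (hφ.continuous.stronglyMeasurableAtFilter _ _) hφ.continuous.continuousAt
  have hderiv : deriv (fun x => ∫ t in (-R)..x, φ t) = φ := funext fun x => (hd x).deriv
  refine ⟨fun x => ∫ t in (-R)..x, φ t, ?_, ?_, hderiv⟩
  · rw [contDiff_infty_iff_deriv]
    exact ⟨fun x => (hd x).differentiableAt, by rw [hderiv]; exact hφ⟩
  -- Left of -R nothing has been integrated yet; right of R the primitive is the full integral,
  -- which is 0.
  · refine HasCompactSupport.of_support_subset_isCompact (isCompact_Icc (a := -R) (b := R)) ?_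
    intro x hx
    by_contra hxn
    refine hx ?_
    simp only
    rcases lt_or_ge x (-R) with h | h
    · rw [intervalIntegral.integral_of_ge h.le, neg_eq_zero]
      refine (setIntegral_congr_ae (g := fun _ => (0 : ℝ)) measurableSet_Ioc ?_).trans (by simp)
      have : ∀ᵐ y : ℝ, y ≠ -R := by simp [ae_iff, measure_singleton]
      filter_upwards [this] with y hy hy'
      exact hz y fun h' => hy (le_antisymm hy'.2 h'.1)
    · have hRx : R < x := by
        by_contra hlt
        exact hxn ⟨h, not_lt.1 hlt⟩
      rw [intervalIntegral.integral_of_le h, ← h0]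
      have : ∀ᵐ y : ℝ, y ≠ -R := by simp [ae_iff, measure_singleton]
      rw [← integral_indicator measurableSet_Ioc]
      refine integral_congr_ae ?_
      filter_upwards [this] with y hy
      by_cases hy' : y ∈ Set.Ioc (-R) x
      · simp [hy']
      · rw [Set.indicator_of_notMem hy', hz y]
        intro h'
        exact hy' ⟨lt_of_le_of_ne h'.1 (Ne.symm hy), h'.2.trans hRx.le⟩

/-- The du Bois-Reymond argument: with ρ a bump of integral 1, φ - (∫φ)ρ is the derivative of a test
function, so ∫φf = (∫φ)(∫ρf). The constant is ∫ρf. -/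
theorem ae_const_of_hasWeakDeriv_zero {f : ℝ → ℂ} (h : HasWeakDeriv f fun _ => 0) :
    ∃ c : ℂ, ∀ᵐ x, f x = c := by
  let η : ContDiffBump (0 : ℝ) := ⟨1, 2, one_pos, one_lt_two⟩
  set ρ : ℝ → ℝ := η.normed volume with hρ
  have hρd : ContDiff ℝ ∞ ρ := η.contDiff_normed
  have hρc : HasCompactSupport ρ := η.hasCompactSupport_normed
  have hρ1 : ∫ x, ρ x = 1 := η.integral_normed
  have hρi : Integrable ρ := hρd.continuous.integrable_of_hasCompactSupport hρc
  have hρf : Integrable fun x => ρ x • f x :=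
    h.1.integrable_smul_left_of_hasCompactSupport hρd.continuous hρc
  refine ⟨∫ x, ρ x • f x, ?_⟩
  refine ae_eq_of_integral_contDiff_smul_eq h.1 continuous_const.locallyIntegrable
    fun φ hφ hc => ?_
  have hφi : Integrable φ := hφ.continuous.integrable_of_hasCompactSupport hc
  have hφf : Integrable fun x => φ x • f x :=
    h.1.integrable_smul_left_of_hasCompactSupport hφ.continuous hc
  have hcs : HasCompactSupport fun x => φ x - (∫ y, φ y) * ρ x :=
    HasCompactSupport.sub hc (hρc.mul_left)
  obtain ⟨Φ, hΦ, hΦc, hΦd⟩ := exists_contDiff_primitive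
    (φ := fun x => φ x - (∫ y, φ y) * ρ x) (hφ.sub (contDiff_const.mul hρd)) hcs (by
      rw [integral_sub hφi (hρi.const_mul _), integral_const_mul, hρ1]; ring)
  have key := h.2.2 Φ hΦ hΦc
  simp only [smul_zero, integral_zero, neg_zero, hΦd, sub_smul, mul_smul] at key
  have hs : Integrable fun x => (∫ y, φ y) • ρ x • f x :=
    Integrable.fun_smul _ hρf
  rw [integral_sub hφf hs, integral_smul, sub_eq_zero] at key
  rw [key, integral_smul_const]

/-- Subtracting a primitive of `g` from `f` leaves a function with zero weak derivative. -/
theorem HasWeakDeriv.exists_isPrimitive {f g : ℝ → ℂ} (h : HasWeakDeriv f g) :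
    ∃ F, f =ᵐ[volume] F ∧ IsPrimitive F g := by
  have hP : IsPrimitive (fun x => ∫ t in (0 : ℝ)..x, g t) g := ⟨h.2.1, fun x => by simp⟩
  have hW := hP.hasWeakDeriv
  obtain ⟨c, hc⟩ := ae_const_of_hasWeakDeriv_zero
    (f := fun x => f x - ∫ t in (0 : ℝ)..x, g t) ⟨h.1.sub hW.1, continuous_const.locallyIntegrable,
      fun φ hφ hφc => by
        have hφ' : Continuous (deriv φ) := hφ.continuous_deriv (by simp)
        simp only [smul_sub, smul_zero, integral_zero, neg_zero]
        rw [integral_sub (h.1.integrable_smul_left_of_hasCompactSupport hφ' hφc.deriv)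
          (hW.1.integrable_smul_left_of_hasCompactSupport hφ' hφc.deriv),
          h.2.2 φ hφ hφc, hW.2.2 φ hφ hφc, sub_self]⟩
  refine ⟨fun x => c + ∫ t in (0 : ℝ)..x, g t, ?_, h.2.1, fun x => by simp⟩
  filter_upwards [hc] with x hx
  rw [← hx]; ring

/-! ### Integral operators on `L²(ℝ)` -/

open scoped ENNReal in
/-- The hypotheses of the Schur test, with the same bound for rows and columns. -/
structure IsSchurKernel (K : ℝ → ℝ → ℂ) (C : ℝ≥0∞) : Prop where
  measurable : Measurable (Function.uncurry K)
  ne_top : C ≠ ⊤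
  row : ∀ x, ∫⁻ y, ‖K x y‖ₑ ≤ C
  col : ∀ y, ∫⁻ x, ‖K x y‖ₑ ≤ C

open scoped ENNReal in
-- Cauchy–Schwarz for the splitting f g = f^{1/2} · (f^{1/2} g), the pointwise half of the Schur
-- test.
theorem sq_lintegral_mul_le {f g : ℝ → ℝ≥0∞} (hf : Measurable f) (hg : Measurable g) :
    (∫⁻ y, f y * g y) ^ (2 : ℝ) ≤ (∫⁻ y, f y) * ∫⁻ y, f y * g y ^ (2 : ℝ) := by
  have h := ENNReal.lintegral_mul_le_Lp_mul_Lq (volume : Measure ℝ)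
    (Real.HolderConjugate.two_two) (f := fun y => f y ^ (1 / 2 : ℝ))
    (g := fun y => f y ^ (1 / 2 : ℝ) * g y) (by fun_prop) (by fun_prop)
  have e1 : ∀ y, ((fun y => f y ^ (1 / 2 : ℝ)) * fun y => f y ^ (1 / 2 : ℝ) * g y) y =
      f y * g y := by
    intro y
    rw [Pi.mul_apply, ← mul_assoc, ← ENNReal.rpow_add_of_nonneg _ _ (by norm_num) (by norm_num)]
    norm_num
  have e2 : ∀ y, (f y ^ (1 / 2 : ℝ)) ^ (2 : ℝ) = f y := by
    intro y
    rw [← ENNReal.rpow_mul]; norm_num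
  have e3 : ∀ y, (f y ^ (1 / 2 : ℝ) * g y) ^ (2 : ℝ) = f y * g y ^ (2 : ℝ) := by
    intro y
    rw [ENNReal.mul_rpow_of_nonneg _ _ (by norm_num), e2]
  simp only [e1, e2, e3] at h
  calc (∫⁻ y, f y * g y) ^ (2 : ℝ)
      ≤ ((∫⁻ y, f y) ^ (1 / 2 : ℝ) * (∫⁻ y, f y * g y ^ (2 : ℝ)) ^ (1 / 2 : ℝ)) ^ (2 : ℝ) := by
        gcongr
    _ = _ := by
        rw [ENNReal.mul_rpow_of_nonneg _ _ (by norm_num), ← ENNReal.rpow_mul, ← ENNReal.rpow_mul]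
        norm_num

namespace IsSchurKernel

open scoped ENNReal

variable {K : ℝ → ℝ → ℂ} {C : ℝ≥0∞}

/-- Weighted Cauchy–Schwarz uses the row bound; exchanging the integrals then uses the column bound.
-/
theorem lintegral_sq_le (hK : IsSchurKernel K C) {v : ℝ → ℂ} (hv : Measurable v) :
    ∫⁻ x, (∫⁻ y, ‖K x y‖ₑ * ‖v y‖ₑ) ^ (2 : ℝ) ≤ C * (C * ∫⁻ y, ‖v y‖ₑ ^ (2 : ℝ)) := by
  have hm : Measurable fun p : ℝ × ℝ => ‖K p.1 p.2‖ₑ := hK.measurable.enorm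
  calc ∫⁻ x, (∫⁻ y, ‖K x y‖ₑ * ‖v y‖ₑ) ^ (2 : ℝ)
      ≤ ∫⁻ x, C * ∫⁻ y, ‖K x y‖ₑ * ‖v y‖ₑ ^ (2 : ℝ) := by
        refine lintegral_mono fun x => ?_
        have hx : Measurable fun y => ‖K x y‖ₑ := hm.comp (measurable_const.prodMk measurable_id)
        exact (sq_lintegral_mul_le hx hv.enorm).trans
          (mul_le_mul_left (hK.row x) _)
    _ = C * ∫⁻ x, ∫⁻ y, ‖K x y‖ₑ * ‖v y‖ₑ ^ (2 : ℝ) := lintegral_const_mul' _ _ hK.ne_top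
    _ = C * ∫⁻ y, ∫⁻ x, ‖K x y‖ₑ * ‖v y‖ₑ ^ (2 : ℝ) := by
        rw [lintegral_lintegral_swap]
        exact (hm.mul ((hv.enorm.pow_const _).comp measurable_snd)).aemeasurable
    _ = C * ∫⁻ y, (∫⁻ x, ‖K x y‖ₑ) * ‖v y‖ₑ ^ (2 : ℝ) := by
        congr 2
        funext y
        have hy : Measurable fun x => ‖K x y‖ₑ := hm.comp (measurable_id.prodMk measurable_const)
        exact lintegral_mul_const _ hy
    _ ≤ C * ∫⁻ y, C * ‖v y‖ₑ ^ (2 : ℝ) := by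
        gcongr with y
        exact hK.col y
    _ = _ := by rw [lintegral_const_mul' _ _ hK.ne_top]

theorem eLpNorm_le (hK : IsSchurKernel K C) {v : ℝ → ℂ} (hv : Measurable v) :
    eLpNorm (fun x => ∫ y, K x y * v y) 2 volume ≤ C * eLpNorm v 2 volume := by
  rw [eLpNorm_eq_lintegral_rpow_enorm_toReal (by norm_num) (by norm_num),
    eLpNorm_eq_lintegral_rpow_enorm_toReal (by norm_num) (by norm_num)]
  simp only [ENNReal.toReal_ofNat]
  have h1 : ∫⁻ x, ‖∫ y, K x y * v y‖ₑ ^ (2 : ℝ) ≤ C * (C * ∫⁻ y, ‖v y‖ₑ ^ (2 : ℝ)) := by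
    refine le_trans (lintegral_mono fun x => ?_) (hK.lintegral_sq_le hv)
    gcongr
    refine (enorm_integral_le_lintegral_enorm _).trans (le_of_eq ?_)
    simp only [enorm_mul]
  calc _ ≤ (C * (C * ∫⁻ y, ‖v y‖ₑ ^ (2 : ℝ))) ^ (1 / 2 : ℝ) := by gcongr
    _ = (C ^ (2 : ℝ)) ^ (1 / 2 : ℝ) * (∫⁻ y, ‖v y‖ₑ ^ (2 : ℝ)) ^ (1 / 2 : ℝ) := by
        rw [← ENNReal.mul_rpow_of_nonneg _ _ (by norm_num), ← mul_assoc, ENNReal.rpow_two, sq]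
    _ = _ := by rw [← ENNReal.rpow_mul]; norm_num

theorem aestronglyMeasurable (hK : IsSchurKernel K C) {v : ℝ → ℂ} (hv : Measurable v) :
    AEStronglyMeasurable (fun x => ∫ y, K x y * v y) volume := by
  have : Measurable fun p : ℝ × ℝ => K p.1 p.2 * v p.2 :=
    hK.measurable.mul (hv.comp measurable_snd)
  exact this.stronglyMeasurable.integral_prod_right'.aestronglyMeasurable

/-- Additivity of `op` needs genuine convergence of the integrals, since a divergent Bochner
integral is 0 by convention. The square-integral bound gives it for almost every x. -/
theorem ae_integrable (hK : IsSchurKernel K C) {v : ℝ → ℂ} (hv : Measurable v)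
    (hv2 : MemLp v 2 volume) : ∀ᵐ x, Integrable fun y => K x y * v y := by
  have hm : Measurable fun p : ℝ × ℝ => ‖K p.1 p.2‖ₑ * ‖v p.2‖ₑ :=
    hK.measurable.enorm.mul (hv.enorm.comp measurable_snd)
  have hfin : ∫⁻ x, (∫⁻ y, ‖K x y‖ₑ * ‖v y‖ₑ) ^ (2 : ℝ) ≠ ⊤ := by
    refine ne_top_of_le_ne_top ?_ (hK.lintegral_sq_le hv)
    have := hv2.eLpNorm_lt_top
    rw [eLpNorm_lt_top_iff_lintegral_rpow_enorm_lt_top (by norm_num) (by norm_num)] at this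
    simp only [ENNReal.toReal_ofNat] at this
    exact ENNReal.mul_ne_top hK.ne_top (ENNReal.mul_ne_top hK.ne_top this.ne)
  filter_upwards [ae_lt_top (hm.lintegral_prod_right'.pow_const _) hfin] with x hx
  have hx' : Measurable fun y => K x y :=
    hK.measurable.comp (measurable_const.prodMk measurable_id)
  refine ⟨(hx'.mul hv).aestronglyMeasurable, ?_⟩
  rw [hasFiniteIntegral_iff_enorm]
  simp only [enorm_mul]
  by_contra h
  rw [not_lt, top_le_iff] at h
  rw [h] at hx
  simp at hx

theorem memLp (hK : IsSchurKernel K C) (v : L2) :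
    MemLp (fun x => ∫ y, K x y * v y) 2 volume :=
  ⟨hK.aestronglyMeasurable (Lp.stronglyMeasurable v).measurable,
    (hK.eLpNorm_le (Lp.stronglyMeasurable v).measurable).trans_lt
      (ENNReal.mul_lt_top hK.ne_top.lt_top (Lp.memLp v).eLpNorm_lt_top)⟩

/-- The bounded operator on `L²(ℝ)` with a kernel satisfying the Schur test. -/
def op (hK : IsSchurKernel K C) : L2 →L[ℂ] L2 :=
  LinearMap.mkContinuous
    { toFun := fun v => (hK.memLp v).toLp _
      map_add' := fun u v => by
        apply Lp.ext
        filter_upwards [(hK.memLp (u + v)).coeFn_toLp, (hK.memLp u).coeFn_toLp,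
          (hK.memLp v).coeFn_toLp, Lp.coeFn_add ((hK.memLp u).toLp _) ((hK.memLp v).toLp _),
          hK.ae_integrable (Lp.stronglyMeasurable u).measurable (Lp.memLp u),
          hK.ae_integrable (Lp.stronglyMeasurable v).measurable (Lp.memLp v)]
          with x h1 h2 h3 h4 h5 h6
        rw [h1, h4, Pi.add_apply, h2, h3, ← integral_add h5 h6]
        refine integral_congr_ae ?_
        filter_upwards [Lp.coeFn_add u v] with y hy
        rw [hy, Pi.add_apply, mul_add]
      map_smul' := fun c v => by
        apply Lp.ext
        filter_upwards [(hK.memLp (c • v)).coeFn_toLp, (hK.memLp v).coeFn_toLp,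
          Lp.coeFn_smul c ((hK.memLp v).toLp _)] with x h1 h2 h3
        rw [RingHom.id_apply, h1, h3, Pi.smul_apply, h2, smul_eq_mul, ← integral_const_mul]
        refine integral_congr_ae ?_
        filter_upwards [Lp.coeFn_smul c v] with y hy
        rw [hy, Pi.smul_apply, smul_eq_mul]
        ring }
    C.toReal fun v => by
      change ‖(hK.memLp v).toLp _‖ ≤ _
      rw [Lp.norm_toLp, Lp.norm_def, ← ENNReal.toReal_mul]
      exact ENNReal.toReal_mono (ENNReal.mul_ne_top hK.ne_top (Lp.eLpNorm_ne_top v))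
        (hK.eLpNorm_le (Lp.stronglyMeasurable v).measurable)

theorem coeFn_op (hK : IsSchurKernel K C) (v : L2) :
    hK.op v =ᵐ[volume] fun x => ∫ y, K x y * v y :=
  (hK.memLp v).coeFn_toLp

end IsSchurKernel

/-! ### Multiplication operators on `L²(ℝ)` and entire families of multipliers -/

/-- The Banach space `L^∞(ℝ)`. -/
abbrev LInf : Type := Lp ℂ ⊤ (volume : Measure ℝ)

/-- Multiplication of `L²` by `L^∞` as a bounded bilinear map. -/
def mulL2 : LInf →L[ℂ] L2 →L[ℂ] L2 :=
  (ContinuousLinearMap.mul ℂ ℂ).holderL volume ⊤ 2 2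

theorem coeFn_mulL2 (m : LInf) (v : L2) : mulL2 m v =ᵐ[volume] fun x => m x * v x :=
  (ContinuousLinearMap.mul ℂ ℂ).coeFn_holder m v

/-- Multiplication in `L^∞` as a bounded bilinear map. -/
def mulLInf : LInf →L[ℂ] LInf →L[ℂ] LInf :=
  (ContinuousLinearMap.mul ℂ ℂ).holderL volume ⊤ ⊤ ⊤

theorem coeFn_mulLInf (m n : LInf) : mulLInf m n =ᵐ[volume] fun x => m x * n x :=
  (ContinuousLinearMap.mul ℂ ℂ).coeFn_holder m n

/-- The functions `m z ∈ L^∞(ℝ)` depend holomorphically on `z ∈ ℂ`. -/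
def IsEntireFamily (m : ℂ → ℝ → ℂ) : Prop :=
  ∃ F : ℂ → LInf, Differentiable ℂ F ∧ ∀ z, F z =ᵐ[volume] m z

theorem memLp_top_of_forall_bound {f : ℝ → ℂ} (hf : Measurable f) (C : ℝ) (h : ∀ x, ‖f x‖ ≤ C) :
    MemLp f ⊤ volume :=
  memLp_top_of_bound hf.aestronglyMeasurable C (Filter.Eventually.of_forall h)

theorem norm_LInf_le {F : LInf} {C : ℝ} (hC : 0 ≤ C) (h : ∀ᵐ x, ‖F x‖ ≤ C) : ‖F‖ ≤ C := by
  rw [Lp.norm_def, eLpNorm_exponent_top]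
  exact ENNReal.toReal_le_of_le_ofReal hC (eLpNormEssSup_le_of_ae_bound h)

namespace IsEntireFamily

variable {m n : ℂ → ℝ → ℂ}

theorem congr (h : IsEntireFamily m) (hmn : ∀ z x, m z x = n z x) : IsEntireFamily n := by
  have : m = n := funext fun z => funext (hmn z)
  exact this ▸ h

theorem add (h : IsEntireFamily m) (h' : IsEntireFamily n) :
    IsEntireFamily fun z x => m z x + n z x := by
  obtain ⟨F, hF, hFm⟩ := h
  obtain ⟨G, hG, hGn⟩ := h'
  refine ⟨fun z => F z + G z, hF.add hG, fun z => ?_⟩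
  filter_upwards [hFm z, hGn z, Lp.coeFn_add (F z) (G z)] with x h1 h2 h3
  rw [h3, Pi.add_apply, h1, h2]

theorem const_mul {c : ℂ → ℂ} (hc : Differentiable ℂ c) (h : IsEntireFamily m) :
    IsEntireFamily fun z x => c z * m z x := by
  obtain ⟨F, hF, hFm⟩ := h
  refine ⟨fun z => c z • F z, hc.smul hF, fun z => ?_⟩
  filter_upwards [hFm z, Lp.coeFn_smul (c z) (F z)] with x h1 h3
  rw [h3, Pi.smul_apply, h1, smul_eq_mul]

theorem mul_indicator (h : IsEntireFamily m) {S : Set ℝ} (hS : MeasurableSet S) :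
    IsEntireFamily fun z => S.indicator (m z) := by
  obtain ⟨F, hF, hFm⟩ := h
  have hs : MemLp (S.indicator fun _ => (1 : ℂ)) ⊤ (volume : Measure ℝ) :=
    memLp_top_of_forall_bound (measurable_const.indicator hS) 1 fun x => by
      by_cases hx : x ∈ S <;> simp [hx]
  refine ⟨fun z => mulLInf (hs.toLp _) (F z), (mulLInf _).differentiable.comp hF, fun z => ?_⟩
  filter_upwards [hFm z, coeFn_mulLInf (hs.toLp _) (F z), hs.coeFn_toLp] with x h1 h2 h3
  rw [h2, h3, h1]
  by_cases hx : x ∈ S <;> simp [hx]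

theorem glue (h : IsEntireFamily m) (h' : IsEntireFamily n) (c : ℝ) :
    IsEntireFamily fun z x => if x < c then m z x else n z x := by
  refine ((h.mul_indicator (measurableSet_Iio (a := c))).add
    (h'.mul_indicator (measurableSet_Ici (a := c)))).congr fun z x => ?_
  by_cases hx : x < c
  · simp [hx, Set.indicator]
  · simp [hx, Set.indicator, not_lt.1 hx]

theorem comp_sub_left (h : IsEntireFamily m) (L : ℝ) :
    IsEntireFamily fun z x => m z (L - x) := by
  obtain ⟨F, hF, hFm⟩ := h
  have hmp : MeasurePreserving (fun x : ℝ => L - x) volume volume :=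
    volume.measurePreserving_sub_left L
  refine ⟨fun z => Lp.compMeasurePreservingₗᵢ ℂ (fun x : ℝ => L - x) hmp (F z),
    (Lp.compMeasurePreservingₗᵢ ℂ (fun x : ℝ => L - x)
      hmp).toContinuousLinearMap.differentiable.comp hF, fun z => ?_⟩
  filter_upwards [Lp.coeFn_compMeasurePreserving (F z) hmp,
    hmp.quasiMeasurePreserving.ae_eq_comp (hFm z)] with x h1 h2
  exact h1.trans h2

/-- Exponentials of a bounded function. -/
theorem exp_mul {κ : ℝ → ℂ} (hκ : Measurable κ) {C : ℝ} (hC : ∀ x, ‖κ x‖ ≤ C) :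
    IsEntireFamily fun z x => exp (z * κ x) := by
  have hC0 : 0 ≤ C := (norm_nonneg _).trans (hC 0)
  have hb : ∀ z x, ‖exp (z * κ x)‖ ≤ Real.exp (‖z‖ * C) := fun z x => by
    refine (norm_exp_le_exp_norm _).trans (Real.exp_le_exp.2 ?_)
    rw [norm_mul]
    gcongr
    exact hC x
  have hE : ∀ z, MemLp (fun x => exp (z * κ x)) ⊤ (volume : Measure ℝ) := fun z =>
    memLp_top_of_forall_bound (by fun_prop) _ (hb z)
  have hD : ∀ z, MemLp (fun x => κ x * exp (z * κ x)) ⊤ (volume : Measure ℝ) := fun z =>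
    memLp_top_of_forall_bound (by fun_prop) (C * Real.exp (‖z‖ * C)) fun x => by
      rw [norm_mul]
      exact mul_le_mul (hC x) (hb z x) (norm_nonneg _) hC0
  refine ⟨fun z => (hE z).toLp _, fun z => ?_, fun z => (hE z).coeFn_toLp⟩
  refine HasDerivAt.differentiableAt (f' := (hD z).toLp _) ?_
  rw [hasDerivAt_iff_isLittleO_nhds_zero]
  -- After e^{zκ} is factored out, the remainder is e^{hκ} - 1 - hκ, at most |hκ|² once |h|C ≤ 1.
  -- The bound is uniform in x, so the derivative exists in the norm of L^∞.
  refine Asymptotics.IsBigO.trans_isLittleO (g := fun h : ℂ => h ^ 2) ?_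
    (Asymptotics.isLittleO_pow_id one_lt_two)
  refine Asymptotics.IsBigO.of_bound (Real.exp (‖z‖ * C) * C ^ 2) ?_
  have hball : ∀ᶠ h : ℂ in nhds 0, ‖h‖ * C ≤ 1 := by
    have : Filter.Tendsto (fun h : ℂ => ‖h‖ * C) (nhds 0) (nhds (‖(0 : ℂ)‖ * C)) :=
      (continuous_norm.mul continuous_const).tendsto 0
    rw [norm_zero, zero_mul] at this
    exact (this.eventually (gt_mem_nhds one_pos)).mono fun h hh => hh.le
  filter_upwards [hball] with h hh
  refine norm_LInf_le (by positivity) ?_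
  filter_upwards [Lp.coeFn_sub ((hE (z + h)).toLp _ - (hE z).toLp _) (h • (hD z).toLp _),
    Lp.coeFn_sub ((hE (z + h)).toLp _) ((hE z).toLp _), Lp.coeFn_smul h ((hD z).toLp _),
    (hE (z + h)).coeFn_toLp, (hE z).coeFn_toLp, (hD z).coeFn_toLp] with x h1 h2 h3 h4 h5 h6
  rw [h1, Pi.sub_apply, h2, Pi.sub_apply, h3, Pi.smul_apply, h4, h5, h6]
  have hhx : ‖h * κ x‖ ≤ ‖h‖ * C := by
    rw [norm_mul]; gcongr; exact hC x
  have e : exp ((z + h) * κ x) - exp (z * κ x) - h • (κ x * exp (z * κ x)) =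
      exp (z * κ x) * (exp (h * κ x) - 1 - h * κ x) := by
    rw [add_mul, exp_add, smul_eq_mul]; ring
  rw [e, norm_mul, norm_pow, mul_assoc, ← mul_pow, mul_comm C]
  refine mul_le_mul (hb z x) ?_ (norm_nonneg _) (Real.exp_pos _).le
  exact (norm_exp_sub_one_sub_id_le (hhx.trans hh)).trans (by gcongr)

/-- Exponentials on a bounded window. -/
theorem indicator_exp (c : ℂ) {S : Set ℝ} (hS : MeasurableSet S) (hb : Bornology.IsBounded S) :
    IsEntireFamily fun z => S.indicator fun x => exp (z * (c * x)) := by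
  obtain ⟨R, hR⟩ := hb.exists_norm_le
  -- The exponent is truncated to S to make it bounded; off S the exponential is then 1, which the
  -- outer indicator removes.
  have h := (exp_mul (κ := S.indicator fun x => c * (x : ℂ))
    ((by fun_prop : Measurable fun x : ℝ => c * (x : ℂ)).indicator hS) (C := ‖c‖ * |R|)
    fun x => by
      by_cases hx : x ∈ S
      · rw [Set.indicator_of_mem hx, norm_mul, norm_real]
        gcongr
        exact (hR x hx).trans (le_abs_self R)
      · rw [Set.indicator_of_notMem hx, norm_zero]
        positivity).mul_indicator hS
  refine h.congr fun z x => ?_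
  by_cases hx : x ∈ S <;> simp [hx]

end IsEntireFamily

/-! ### Solutions in a layered medium -/

/-- `ψ` with flux `p = a ∂ψ` solves `∂(a ∂ψ) = s² ψ`. -/
structure IsSolution (a : ℝ → ℝ) (s : ℂ) (ψ p : ℝ → ℂ) : Prop where
  left : IsPrimitive ψ fun x => ((a x : ℂ))⁻¹ * p x
  right : IsPrimitive p fun x => s ^ 2 * ψ x

/-- The pairs `(det D_{n+1}, det D̃_{n+1})`, extended to the leftmost layer `n = 0`. -/
def layerPair (b x : ℕ → ℝ) (s : ℂ) : ℕ → ℂ × ℂ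
  | 0 => (-1, 0)
  | (m + 1) =>
    let D := (layerPair b x s m).1
    let D' := (layerPair b x s m).2
    (exp (-s * b (m + 2) * x (m + 1)) *
        ((b (m + 1) - b (m + 2)) * exp (-s * b (m + 1) * x (m + 1)) * D' -
          (b (m + 1) + b (m + 2)) * exp (s * b (m + 1) * x (m + 1)) * D),
      exp (s * b (m + 2) * x (m + 1)) *
        ((b (m + 1) - b (m + 2)) * exp (s * b (m + 1) * x (m + 1)) * D -
          (b (m + 1) + b (m + 2)) * exp (-s * b (m + 1) * x (m + 1)) * D'))

/-- Layers are counted from 0, so layer n carries the index n + 1. Starting from (-1, 0), which with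
`layerNorm` equal to -1 is the pure wave e^{s b₁ y}, one recursion step produces the prescribed pair
with index 2. -/
theorem layerPair_succ_eq_detPair (b x : ℕ → ℝ) (s : ℂ) (n : ℕ) :
    layerPair b x s (n + 1) = detPair b x s (n + 2) := by
  induction n with
  | zero =>
    simp only [layerPair, detPair]
    rw [show -s * (x 1 : ℂ) * (b 2 - b 1) = -s * b 2 * x 1 + s * b 1 * x 1 by ring,
      show s * (x 1 : ℂ) * (b 1 + b 2) = s * b 2 * x 1 + s * b 1 * x 1 by ring, exp_add, exp_add]
    ext <;> simp only <;> ring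
  | succ n ih =>
    rw [layerPair, detPair, ih]

section Layers

variable (b x : ℕ → ℝ) (s : ℂ)

/-- In terms of the interface values p = D e^{sbx} and q = D̃ e^{-sbx} the recursion is a real
symmetric 2×2 matrix, free of exponentials. Continuity, energy balance and invertibility are all
read off from it. -/
theorem layerPair_succ_matching (n : ℕ) :
    (layerPair b x s (n + 1)).1 * exp (s * b (n + 2) * x (n + 1)) =
      (b (n + 1) - b (n + 2)) * ((layerPair b x s n).2 * exp (-s * b (n + 1) * x (n + 1))) -
        (b (n + 1) + b (n + 2)) * ((layerPair b x s n).1 * exp (s * b (n + 1) * x (n + 1))) ∧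
    (layerPair b x s (n + 1)).2 * exp (-s * b (n + 2) * x (n + 1)) =
      (b (n + 1) - b (n + 2)) * ((layerPair b x s n).1 * exp (s * b (n + 1) * x (n + 1))) -
        (b (n + 1) + b (n + 2)) * ((layerPair b x s n).2 * exp (-s * b (n + 1) * x (n + 1))) := by
  have e : exp (s * b (n + 2) * x (n + 1)) * exp (-s * b (n + 2) * x (n + 1)) = 1 := by
    rw [← exp_add, ← exp_zero]; congr 1; ring
  constructor
  · rw [layerPair]
    linear_combination ((b (n + 1) - b (n + 2)) * exp (-s * b (n + 1) * x (n + 1)) *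
      (layerPair b x s n).2 - (b (n + 1) + b (n + 2)) * exp (s * b (n + 1) * x (n + 1)) *
      (layerPair b x s n).1) * e
  · rw [layerPair]
    linear_combination ((b (n + 1) - b (n + 2)) * exp (s * b (n + 1) * x (n + 1)) *
      (layerPair b x s n).1 - (b (n + 1) + b (n + 2)) * exp (-s * b (n + 1) * x (n + 1)) *
      (layerPair b x s n).2) * e

/-- The normalization that makes the layer solutions match. -/
def layerNorm : ℕ → ℝ
  | 0 => -1
  | (m + 1) => -layerNorm m / (2 * b (m + 1))

/-- The left-outgoing solution in layer `n`. -/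
def layerSol (n : ℕ) (y : ℝ) : ℂ :=
  layerNorm b n * ((layerPair b x s n).1 * exp (s * b (n + 1) * y) -
    (layerPair b x s n).2 * exp (-s * b (n + 1) * y))

/-- The flux of the left-outgoing solution in layer `n`. -/
def layerFlux (n : ℕ) (y : ℝ) : ℂ :=
  layerNorm b n * (s / b (n + 1)) * ((layerPair b x s n).1 * exp (s * b (n + 1) * y) +
    (layerPair b x s n).2 * exp (-s * b (n + 1) * y))

/-- The step function with values `b_j⁻²` in the first `n + 1` layers. -/
def stepCoeff : ℕ → ℝ → ℝ
  | 0, _ => (b 1 ^ 2)⁻¹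
  | (m + 1), y => if y < x (m + 1) then stepCoeff m y else (b (m + 2) ^ 2)⁻¹

/-- The left-outgoing solution for `stepCoeff b x n`. -/
def jost : ℕ → ℝ → ℂ
  | 0, y => layerSol b x s 0 y
  | (m + 1), y => if y < x (m + 1) then jost m y else layerSol b x s (m + 1) y

/-- The flux of the left-outgoing solution for `stepCoeff b x n`. -/
def jostFlux : ℕ → ℝ → ℂ
  | 0, y => layerFlux b x s 0 y
  | (m + 1), y => if y < x (m + 1) then jostFlux m y else layerFlux b x s (m + 1) y

variable {b x}

theorem layerNorm_ne_zero (hb : ∀ n, 0 < b n) (n : ℕ) : layerNorm b n ≠ 0 := by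
  induction n with
  | zero => simp [layerNorm]
  | succ n ih =>
    rw [layerNorm]
    exact div_ne_zero (neg_ne_zero.2 ih) (mul_pos two_pos (hb _)).ne'

theorem hasDerivAt_exp_mul (c : ℂ) (y : ℝ) :
    HasDerivAt (fun y : ℝ => exp (c * y)) (c * exp (c * y)) y := by
  have h : HasDerivAt (fun y : ℝ => c * (y : ℂ)) c y := by
    simpa using (hasDerivAt_id y).ofReal_comp.const_mul c
  exact h.cexp.congr_deriv (mul_comm _ _)

theorem isSolution_layer (hb : ∀ n, 0 < b n) (n : ℕ) :
    IsSolution (fun _ => (b (n + 1) ^ 2)⁻¹) s (layerSol b x s n) (layerFlux b x s n) := by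
  have hb' : (b (n + 1) : ℂ) ≠ 0 := ofReal_ne_zero.2 (hb _).ne'
  constructor
  · refine IsPrimitive.of_hasDerivAt (fun y => ?_) (by unfold layerFlux; fun_prop)
    refine ((((hasDerivAt_exp_mul (s * b (n + 1)) y).const_mul (layerPair b x s n).1).sub
      ((hasDerivAt_exp_mul (-s * b (n + 1)) y).const_mul
        (layerPair b x s n).2)).const_mul (layerNorm b n : ℂ)).congr_deriv ?_
    unfold layerFlux
    push_cast
    field_simp
    ring
  · refine IsPrimitive.of_hasDerivAt (fun y => ?_) (by unfold layerSol; fun_prop)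
    refine ((((hasDerivAt_exp_mul (s * b (n + 1)) y).const_mul (layerPair b x s n).1).add
      ((hasDerivAt_exp_mul (-s * b (n + 1)) y).const_mul
        (layerPair b x s n).2)).const_mul (layerNorm b n * (s / b (n + 1)) : ℂ)).congr_deriv ?_
    unfold layerSol
    field_simp
    ring

/-- With b, b' the parameters on the two sides, the recursion gives p' - q' = -2b(p - q) and p' + q'
= -2b'(p + q). The first forces the factor -1/(2b) in `layerNorm`, and the second then makes the
fluxes agree. -/
theorem layer_matching (hb : ∀ n, 0 < b n) (n : ℕ) :
    layerSol b x s n (x (n + 1)) = layerSol b x s (n + 1) (x (n + 1)) ∧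
      layerFlux b x s n (x (n + 1)) = layerFlux b x s (n + 1) (x (n + 1)) := by
  have hb1 : (b (n + 1) : ℂ) ≠ 0 := ofReal_ne_zero.2 (hb _).ne'
  have hb2 : (b (n + 2) : ℂ) ≠ 0 := ofReal_ne_zero.2 (hb _).ne'
  obtain ⟨h1, h2⟩ := layerPair_succ_matching b x s n
  constructor
  · rw [layerSol, layerSol, h1, h2, layerNorm]
    push_cast
    field_simp
    ring
  · rw [layerFlux, layerFlux, h1, h2, layerNorm]
    push_cast
    field_simp
    ring

theorem jost_of_le (n : ℕ) {y : ℝ} (hy : x n ≤ y) :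
    jost b x s n y = layerSol b x s n y := by
  cases n with
  | zero => rfl
  | succ n => rw [jost, if_neg (not_lt.2 hy)]

theorem jostFlux_of_le (n : ℕ) {y : ℝ} (hy : x n ≤ y) :
    jostFlux b x s n y = layerFlux b x s n y := by
  cases n with
  | zero => rfl
  | succ n => rw [jostFlux, if_neg (not_lt.2 hy)]

theorem jost_of_lt (hx : Monotone x) (n : ℕ) {y : ℝ} (hy : y < x 1) :
    jost b x s n y = layerSol b x s 0 y := by
  induction n with
  | zero => rfl
  | succ n ih => rw [jost, if_pos (hy.trans_le (hx (by omega))), ih]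

theorem jostFlux_of_lt (hx : Monotone x) (n : ℕ) {y : ℝ} (hy : y < x 1) :
    jostFlux b x s n y = layerFlux b x s 0 y := by
  induction n with
  | zero => rfl
  | succ n ih => rw [jostFlux, if_pos (hy.trans_le (hx (by omega))), ih]

theorem isSolution_jost (hb : ∀ n, 0 < b n) (hx : Monotone x) (n : ℕ) :
    IsSolution (stepCoeff b x n) s (jost b x s n) (jostFlux b x s n) := by
  induction n with
  | zero => exact isSolution_layer s hb 0
  | succ n ih =>
    have hl := isSolution_layer (x := x) s hb (n + 1)
    obtain ⟨m1, m2⟩ := layer_matching (x := x) s hb n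
    -- The interfaces are ordered, so the solution glued so far is given at the new interface by the
    -- formula of layer n.
    rw [← jost_of_le s n (hx (Nat.le_succ n))] at m1
    rw [← jostFlux_of_le s n (hx (Nat.le_succ n))] at m2
    constructor
    · convert ih.left.glue hl.left (x (n + 1)) m1 using 1
      · funext y
        rw [jost]
      · funext y
        by_cases hy : y < x (n + 1) <;> simp [hy, stepCoeff, jostFlux]
    · convert ih.right.glue hl.right (x (n + 1)) m2 using 1
      · funext y
        rw [jostFlux]
      · funext y
        by_cases hy : y < x (n + 1) <;> simp [hy, jost]

/-! ### Holomorphic dependence on the spectral parameter -/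

theorem differentiable_layerPair (n : ℕ) :
    Differentiable ℂ (fun s => (layerPair b x s n).1) ∧
      Differentiable ℂ fun s => (layerPair b x s n).2 := by
  induction n with
  | zero => simp [layerPair]
  | succ n ih =>
    obtain ⟨h1, h2⟩ := ih
    simp only [layerPair]
    constructor <;> fun_prop

theorem isEntireFamily_layerSol (n : ℕ) {S : Set ℝ} (hS : MeasurableSet S)
    (hbd : Bornology.IsBounded S) :
    IsEntireFamily fun s => S.indicator (layerSol b x s n) := by
  obtain ⟨h1, h2⟩ := differentiable_layerPair (b := b) (x := x) n
  refine (((IsEntireFamily.indicator_exp (b (n + 1)) hS hbd).const_mul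
    (h1.const_mul (layerNorm b n : ℂ))).add
    ((IsEntireFamily.indicator_exp (-b (n + 1)) hS hbd).const_mul
    (h2.const_mul (-layerNorm b n : ℂ)))).congr fun s y => ?_
  by_cases hy : y ∈ S
  · simp only [Set.indicator_of_mem hy, layerSol]
    rw [show s * ((b (n + 1) : ℂ) * y) = s * b (n + 1) * y by ring,
      show s * (-(b (n + 1) : ℂ) * y) = -s * b (n + 1) * y by ring]
    ring
  · simp [Set.indicator_of_notMem hy]

theorem isEntireFamily_jost (n : ℕ) {S : Set ℝ} (hS : MeasurableSet S)
    (hbd : Bornology.IsBounded S) :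
    IsEntireFamily fun s => S.indicator (jost b x s n) := by
  induction n with
  | zero => exact isEntireFamily_layerSol 0 hS hbd
  | succ n ih =>
    refine (ih.glue (isEntireFamily_layerSol (b := b) (x := x) (n + 1) hS hbd)
      (x (n + 1))).congr fun s y => ?_
    by_cases hy : y ∈ S <;> simp [hy, jost]

/-! ### Zeros of the determinants -/

/-- The matching matrix preserves |p|² - |q|² up to the factor 4ββ'. For imaginary s this is
conservation of the energy flux. -/
theorem normSq_matching (β β' : ℝ) (p q : ℂ) :
    normSq ((β - β') * q - (β + β') * p) - normSq ((β - β') * p - (β + β') * q) =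
      4 * β * β' * (normSq p - normSq q) := by
  simp only [normSq_apply, sub_re, sub_im, mul_re, mul_im, add_re, add_im, ofReal_re, ofReal_im]
  ring

/-- The strict inequality crosses an interface by `normSq_matching`. Inside a layer, moving right
with Re s ≥ 0 does not decrease the right side and does not increase the left side. -/
theorem norm_layerPair_lt (hb : ∀ n, 0 < b n) (hx : Monotone x) (hs : 0 ≤ s.re) (n : ℕ)
    {y : ℝ} (hy : x n ≤ y) :
    ‖(layerPair b x s n).2 * exp (-s * b (n + 1) * y)‖ <
      ‖(layerPair b x s n).1 * exp (s * b (n + 1) * y)‖ := by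
  induction n generalizing y with
  | zero => simp [layerPair, norm_exp, Real.exp_pos]
  | succ n ih =>
    have h := ih (hx (Nat.le_succ n))
    obtain ⟨m1, m2⟩ := layerPair_succ_matching b x s n
    have key := normSq_matching (b (n + 1)) (b (n + 2))
      ((layerPair b x s n).1 * exp (s * b (n + 1) * x (n + 1)))
      ((layerPair b x s n).2 * exp (-s * b (n + 1) * x (n + 1)))
    rw [← m1, ← m2] at key
    have h' : ‖(layerPair b x s (n + 1)).2 * exp (-s * b (n + 2) * x (n + 1))‖ <
        ‖(layerPair b x s (n + 1)).1 * exp (s * b (n + 2) * x (n + 1))‖ := by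
      refine lt_of_pow_lt_pow_left₀ 2 (norm_nonneg _) ?_
      rw [← normSq_eq_norm_sq, ← normSq_eq_norm_sq, ← sub_pos, key, normSq_eq_norm_sq,
        normSq_eq_norm_sq]
      exact mul_pos (mul_pos (mul_pos four_pos (hb _)) (hb _))
        (sub_pos.2 (pow_lt_pow_left₀ h (norm_nonneg _) two_ne_zero))
    have hre : 0 ≤ s.re * b (n + 2) := mul_nonneg hs (hb _).le
    simp only [norm_mul, norm_exp, mul_re, neg_re, neg_im, ofReal_re, ofReal_im, mul_im,
      mul_zero, sub_zero] at h' ⊢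
    refine lt_of_le_of_lt ?_ (h'.trans_le ?_)
    · gcongr ‖_‖ * Real.exp ?_
      nlinarith
    · gcongr ‖_‖ * Real.exp ?_
      nlinarith

theorem layerPair_fst_ne_zero (hb : ∀ n, 0 < b n) (hx : Monotone x) (hs : 0 ≤ s.re) (n : ℕ) :
    (layerPair b x s n).1 ≠ 0 := fun h => by
  have := norm_layerPair_lt s hb hx hs n le_rfl
  rw [h, zero_mul, norm_zero] at this
  exact absurd this (not_lt.2 (norm_nonneg _))

/-- The matching matrix has determinant (β + β')² - (β - β')² = 4ββ' ≠ 0, so a common zero would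
propagate back to the pair (-1, 0). -/
theorem layerPair_ne_zero (hb : ∀ n, 0 < b n) (n : ℕ) :
    ¬ ((layerPair b x s n).1 = 0 ∧ (layerPair b x s n).2 = 0) := by
  induction n with
  | zero => simp [layerPair]
  | succ n ih =>
    rintro ⟨h1, h2⟩
    obtain ⟨m1, m2⟩ := layerPair_succ_matching b x s n
    rw [h1, zero_mul] at m1
    rw [h2, zero_mul] at m2
    have hb1 : (b (n + 1) : ℂ) ≠ 0 := ofReal_ne_zero.2 (hb _).ne'
    have hb2 : (b (n + 2) : ℂ) ≠ 0 := ofReal_ne_zero.2 (hb _).ne'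
    have hbb : (4 * b (n + 1) * b (n + 2) : ℂ) ≠ 0 :=
      mul_ne_zero (mul_ne_zero (by norm_num) hb1) hb2
    refine ih ⟨?_, ?_⟩
    · have : (4 * b (n + 1) * b (n + 2) : ℂ) *
          ((layerPair b x s n).1 * exp (s * b (n + 1) * x (n + 1))) = 0 := by
        linear_combination (b (n + 1) + b (n + 2) : ℂ) * m1 + (b (n + 1) - b (n + 2) : ℂ) * m2
      exact ((mul_eq_zero.1 ((mul_eq_zero.1 this).resolve_left hbb))).resolve_right (exp_ne_zero _)
    · have : (4 * b (n + 1) * b (n + 2) : ℂ) *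
          ((layerPair b x s n).2 * exp (-s * b (n + 1) * x (n + 1))) = 0 := by
        linear_combination (b (n + 1) - b (n + 2) : ℂ) * m1 + (b (n + 1) + b (n + 2) : ℂ) * m2
      exact ((mul_eq_zero.1 ((mul_eq_zero.1 this).resolve_left hbb))).resolve_right (exp_ne_zero _)

end Layers

/-! ### Wronskians and weak solutions -/

theorem HasWeakDeriv.sub {f g F G : ℝ → ℂ} (h : HasWeakDeriv f g) (H : HasWeakDeriv F G) :
    HasWeakDeriv (fun x => f x - F x) (fun x => g x - G x) := by
  refine ⟨h.1.sub H.1, h.2.1.sub H.2.1, fun φ hφ hc => ?_⟩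
  have hφ' : Continuous (deriv φ) := hφ.continuous_deriv (by simp)
  simp only [smul_sub]
  rw [integral_sub (h.1.integrable_smul_left_of_hasCompactSupport hφ' hc.deriv)
      (H.1.integrable_smul_left_of_hasCompactSupport hφ' hc.deriv),
    integral_sub (h.2.1.integrable_smul_left_of_hasCompactSupport hφ.continuous hc)
      (H.2.1.integrable_smul_left_of_hasCompactSupport hφ.continuous hc),
    h.2.2 φ hφ hc, H.2.2 φ hφ hc]
  ring

/-- A weak solution agrees almost everywhere with a continuous one with continuous flux. -/
theorem exists_isSolution_of_hasWeakDeriv {a : ℝ → ℝ} (ha : ∀ x, a x ≠ 0) {s : ℂ}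
    {ψ w : ℝ → ℂ} (h₁ : HasWeakDeriv ψ w)
    (h₂ : HasWeakDeriv (fun x => (a x : ℂ) * w x) fun x => s ^ 2 * ψ x) :
    ∃ Ψ P, ψ =ᵐ[volume] Ψ ∧ IsSolution a s Ψ P := by
  obtain ⟨Ψ, hΨ, hΨP⟩ := h₁.exists_isPrimitive
  obtain ⟨P, hP, hPP⟩ := h₂.exists_isPrimitive
  refine ⟨Ψ, P, hΨ, hΨP.congr_ae ?_, hPP.congr_ae ?_⟩
  · filter_upwards [hP] with x hx
    rw [← hx, inv_mul_cancel_left₀ (ofReal_ne_zero.2 (ha x))]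
  · filter_upwards [hΨ] with x hx
    rw [hx]

theorem memL2Loc_of_continuous {f : ℝ → ℂ} (hf : Continuous f) : MemL2Loc f := fun K hK => by
  obtain ⟨C, hC⟩ := hK.exists_bound_of_continuousOn hf.continuousOn
  have : IsFiniteMeasure (volume.restrict K) := ⟨by
    rw [Measure.restrict_apply_univ]; exact hK.measure_lt_top⟩
  exact MemLp.of_bound hf.aestronglyMeasurable C (ae_restrict_of_forall_mem hK.measurableSet hC)

namespace IsSolution

variable {a : ℝ → ℝ} {s : ℂ} {ψ p θ q : ℝ → ℂ}

/-- By the product rule for primitives, the derivative of the Wronskian cancels identically. -/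
theorem wronskian_eq (h : IsSolution a s ψ p) (H : IsSolution a s θ q) (x y : ℝ) :
    ψ x * q x - θ x * p x = ψ y * q y - θ y * p y := by
  refine IsPrimitive.zero_eq (f := fun x => ψ x * q x - θ x * p x) ?_ x y
  refine ((h.left.mul H.right).sub (H.left.mul h.right)).congr_ae
    (Filter.Eventually.of_forall fun t => ?_)
  ring

theorem congr_coeff (h : IsSolution a s ψ p) {a' : ℝ → ℝ} (ha : a =ᵐ[volume] a') :
    IsSolution a' s ψ p :=
  ⟨h.left.congr_ae (ha.mono fun x hx => by simp only [hx]), h.right⟩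

theorem comp_sub_left (h : IsSolution a s ψ p) (L : ℝ) :
    IsSolution (fun x => a (L - x)) s (fun x => ψ (L - x)) fun x => -p (L - x) := by
  constructor
  · refine (h.left.comp_sub_left L).congr_ae (Filter.Eventually.of_forall fun t => ?_)
    ring
  · have := (h.right.comp_sub_left L).const_mul (-1)
    simp only [neg_mul, one_mul, neg_neg] at this
    exact this

/-- Every solution is a combination of two solutions with nonvanishing Wronskian. -/
theorem exists_combination {θ₁ q₁ θ₂ q₂ : ℝ → ℂ} (h : IsSolution a s ψ p)
    (h₁ : IsSolution a s θ₁ q₁) (h₂ : IsSolution a s θ₂ q₂) {W : ℂ} (hW0 : W ≠ 0)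
    (hW : ∀ x, θ₁ x * q₂ x - θ₂ x * q₁ x = W) :
    ∃ α β : ℂ, ∀ x, ψ x = α * θ₁ x + β * θ₂ x := by
  -- Cramer's rule: the coefficients are quotients of Wronskians, hence constant, and can be
  -- evaluated at x instead of 0.
  refine ⟨(ψ 0 * q₂ 0 - θ₂ 0 * p 0) / W, (θ₁ 0 * p 0 - ψ 0 * q₁ 0) / W, fun x => ?_⟩
  rw [h.wronskian_eq h₂ 0 x, h₁.wronskian_eq h 0 x]
  field_simp
  rw [← hW x]
  ring

theorem hasH1LocDeriv_flux (h : IsSolution a s ψ p) :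
    HasH1LocDeriv p fun x => s ^ 2 * ψ x :=
  ⟨memL2Loc_of_continuous h.right.continuous,
    memL2Loc_of_continuous (continuous_const.mul h.left.continuous), h.right.hasWeakDeriv⟩

theorem hasH1LocDeriv (h : IsSolution a s ψ p) (ha : Measurable a) {C : ℝ}
    (hC : ∀ x, |(a x)⁻¹| ≤ C) : HasH1LocDeriv ψ fun x => (a x : ℂ)⁻¹ * p x := by
  refine ⟨memL2Loc_of_continuous h.left.continuous, fun K hK => ?_, h.left.hasWeakDeriv⟩
  refine MemLp.of_le_mul (c := C) (memL2Loc_of_continuous h.right.continuous K hK) ?_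
    (Filter.Eventually.of_forall fun x => ?_)
  · have := h.right.continuous.measurable
    exact Measurable.aestronglyMeasurable (by fun_prop)
  · rw [norm_mul, ← ofReal_inv, norm_real, Real.norm_eq_abs]
    gcongr
    exact hC x

end IsSolution

/-! ### Green kernels -/

theorem integrable_exp_neg_mul_abs {κ : ℝ} (hκ : 0 < κ) :
    Integrable fun t : ℝ => Real.exp (-κ * |t|) := by
  rw [← integrableOn_univ, ← Set.Iic_union_Ioi (a := (0 : ℝ))]
  refine IntegrableOn.union ?_ ?_
  · refine (integrableOn_exp_mul_Iic hκ 0).congr_fun (fun t ht => ?_) measurableSet_Iic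
    simp only [abs_of_nonpos (Set.mem_Iic.1 ht)]
    congr 1; ring
  · refine (integrableOn_exp_mul_Ioi (neg_lt_zero.2 hκ) 0).congr_fun (fun t ht => ?_)
      measurableSet_Ioi
    simp only [abs_of_pos (Set.mem_Ioi.1 ht)]

open scoped ENNReal in
-- Under a dominating convolution kernel, every row and column integral is bounded by the same
-- integral, by translation and reflection invariance.
theorem isSchurKernel_of_le {K : ℝ → ℝ → ℂ} (hK : Measurable (Function.uncurry K))
    {h : ℝ → ℝ} (hh : Integrable h) (hle : ∀ x y, ‖K x y‖ ≤ h (x - y)) :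
    IsSchurKernel K (∫⁻ t, ENNReal.ofReal (h t)) := by
  have hle' : ∀ x y, ‖K x y‖ₑ ≤ ENNReal.ofReal (h (x - y)) := fun x y => by
    rw [← ofReal_norm]
    exact ENNReal.ofReal_le_ofReal (hle x y)
  refine ⟨hK, ?_, fun x => ?_, fun y => ?_⟩
  · exact hh.lintegral_lt_top.ne
  · exact (lintegral_mono (hle' x)).trans
      (lintegral_sub_left_eq_self (fun t => ENNReal.ofReal (h t)) x).le
  · exact (lintegral_mono fun x => hle' x y).trans
      (lintegral_sub_right_eq_self (fun t => ENNReal.ofReal (h t)) y).le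

/-- The kernel `f₁(x) g₁(y)` for `y ≤ x`, and `f₂(x) g₂(y)` for `x < y`. -/
def greenKernel (f₁ g₁ f₂ g₂ : ℝ → ℂ) (x y : ℝ) : ℂ :=
  if y ≤ x then f₁ x * g₁ y else f₂ x * g₂ y

theorem measurable_greenKernel {f₁ g₁ f₂ g₂ : ℝ → ℂ} (hf₁ : Measurable f₁) (hg₁ : Measurable g₁)
    (hf₂ : Measurable f₂) (hg₂ : Measurable g₂) :
    Measurable (Function.uncurry (greenKernel f₁ g₁ f₂ g₂)) := by
  refine Measurable.ite (measurableSet_le measurable_snd measurable_fst) ?_ ?_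
  · exact (hf₁.comp measurable_fst).mul (hg₁.comp measurable_snd)
  · exact (hf₂.comp measurable_fst).mul (hg₂.comp measurable_snd)

/-- `f` is bounded by a multiple of `e^{κ x}`. -/
def ExpBound (κ : ℝ) (f : ℝ → ℂ) : Prop :=
  ∃ C : ℝ, 0 ≤ C ∧ ∀ x, ‖f x‖ ≤ C * Real.exp (κ * x)

theorem exists_isSchurKernel_green {κ : ℝ} (hκ : 0 < κ) {f₁ g₁ f₂ g₂ : ℝ → ℂ}
    (hf₁ : Measurable f₁) (hg₁ : Measurable g₁) (hf₂ : Measurable f₂) (hg₂ : Measurable g₂)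
    (bf₁ : ExpBound (-κ) f₁) (bg₁ : ExpBound κ g₁) (bf₂ : ExpBound κ f₂) (bg₂ : ExpBound (-κ) g₂) :
    ∃ C, IsSchurKernel (greenKernel f₁ g₁ f₂ g₂) C := by
  obtain ⟨A₁, hA₁, hfA₁⟩ := bf₁
  obtain ⟨B₁, hB₁, hgB₁⟩ := bg₁
  obtain ⟨A₂, hA₂, hfA₂⟩ := bf₂
  obtain ⟨B₂, hB₂, hgB₂⟩ := bg₂
  refine ⟨_, isSchurKernel_of_le (measurable_greenKernel hf₁ hg₁ hf₂ hg₂)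
    ((integrable_exp_neg_mul_abs hκ).const_mul (A₁ * B₁ + A₂ * B₂)) fun x y => ?_⟩
  have e0 : 0 < Real.exp (-κ * |x - y|) := Real.exp_pos _
  unfold greenKernel
  split_ifs with hxy
  · have e : Real.exp (-κ * x) * Real.exp (κ * y) = Real.exp (-κ * |x - y|) := by
      rw [← Real.exp_add, abs_of_nonneg (sub_nonneg.2 hxy)]
      congr 1; ring
    calc ‖f₁ x * g₁ y‖ ≤ (A₁ * Real.exp (-κ * x)) * (B₁ * Real.exp (κ * y)) := by
          rw [norm_mul]
          exact mul_le_mul (hfA₁ x) (hgB₁ y) (norm_nonneg _) (by positivity)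
      _ = A₁ * B₁ * Real.exp (-κ * |x - y|) := by rw [← e]; ring
      _ ≤ _ := by gcongr; exact le_add_of_nonneg_right (by positivity)
  · have e : Real.exp (κ * x) * Real.exp (-κ * y) = Real.exp (-κ * |x - y|) := by
      rw [← Real.exp_add, abs_of_neg (sub_neg.2 (not_le.1 hxy))]
      congr 1; ring
    calc ‖f₂ x * g₂ y‖ ≤ (A₂ * Real.exp (κ * x)) * (B₂ * Real.exp (-κ * y)) := by
          rw [norm_mul]
          exact mul_le_mul (hfA₂ x) (hgB₂ y) (norm_nonneg _) (by positivity)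
      _ = A₂ * B₂ * Real.exp (-κ * |x - y|) := by rw [← e]; ring
      _ ≤ _ := by gcongr; exact le_add_of_nonneg_left (by positivity)

/-- The exponential e^{κy} is square integrable towards -∞, so Cauchy–Schwarz applies. -/
theorem ExpBound.integrableOn_mul_Iic {κ : ℝ} (hκ : 0 < κ) {g : ℝ → ℂ} (hg : Measurable g)
    (bg : ExpBound κ g) {v : ℝ → ℂ} (hv : MemLp v 2 volume) (x : ℝ) :
    IntegrableOn (fun y => g y * v y) (Set.Iic x) := by
  obtain ⟨C, hC, hgC⟩ := bg
  have hE : MemLp (fun y => C * Real.exp (κ * y)) 2 (volume.restrict (Set.Iic x)) := by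
    refine MemLp.const_mul ?_ C
    rw [memLp_two_iff_integrable_sq (by fun_prop)]
    refine (integrableOn_exp_mul_Iic (a := 2 * κ) (by linarith) x).congr_fun (fun t _ => ?_)
      measurableSet_Iic
    simp only
    rw [← Real.exp_nat_mul]
    congr 1; push_cast; ring
  have hg2 : MemLp g 2 (volume.restrict (Set.Iic x)) :=
    hE.of_le hg.aestronglyMeasurable (Filter.Eventually.of_forall fun y =>
      (hgC y).trans (le_abs_self _))
  exact hg2.integrable_mul (hv.restrict _)

theorem ExpBound.comp_neg {κ : ℝ} {g : ℝ → ℂ} (bg : ExpBound (-κ) g) :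
    ExpBound κ fun y => g (-y) := by
  obtain ⟨C, hC, hgC⟩ := bg
  exact ⟨C, hC, fun x => (hgC (-x)).trans (le_of_eq (by ring_nf))⟩

theorem ExpBound.integrableOn_mul_Ioi {κ : ℝ} (hκ : 0 < κ) {g : ℝ → ℂ} (hg : Measurable g)
    (bg : ExpBound (-κ) g) {v : ℝ → ℂ} (hv : MemLp v 2 volume) (x : ℝ) :
    IntegrableOn (fun y => g y * v y) (Set.Ioi x) := by
  have hv' : MemLp (fun y => v (-y)) 2 volume :=
    hv.comp_measurePreserving (Measure.measurePreserving_neg volume)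
  have h := bg.comp_neg.integrableOn_mul_Iic hκ (hg.comp measurable_neg) hv' (-x)
  have h2 := (h.mono_set Set.Iio_subset_Iic_self).comp_neg_Ioi
  simpa using h2

/-- The integral of a Green kernel against a function is a primitive. -/
theorem isPrimitive_green {f₁ g₁ f₂ g₂ f₁' f₂' v : ℝ → ℂ} (hf₁ : IsPrimitive f₁ f₁')
    (hf₂ : IsPrimitive f₂ f₂')
    (h₁ : ∀ x, IntegrableOn (fun y => g₁ y * v y) (Set.Iic x))
    (h₂ : ∀ x, IntegrableOn (fun y => g₂ y * v y) (Set.Ioi x)) :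
    IsPrimitive (fun x => ∫ y, greenKernel f₁ g₁ f₂ g₂ x y * v y)
      (fun x => (∫ y, greenKernel f₁' g₁ f₂' g₂ x y * v y) +
        (f₁ x * g₁ x - f₂ x * g₂ x) * v x) := by
  have key : ∀ (F₁ F₂ : ℝ → ℂ) (x : ℝ), ∫ y, greenKernel F₁ g₁ F₂ g₂ x y * v y =
      F₁ x * (∫ y in Set.Iic x, g₁ y * v y) + F₂ x * ∫ y in Set.Ioi x, g₂ y * v y := by
    intro F₁ F₂ x
    have e1 : Set.EqOn (fun y => F₁ x * (g₁ y * v y))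
        (fun y => greenKernel F₁ g₁ F₂ g₂ x y * v y) (Set.Iic x) := fun y hy => by
      simp only [greenKernel, if_pos (Set.mem_Iic.1 hy)]; ring
    have e2 : Set.EqOn (fun y => F₂ x * (g₂ y * v y))
        (fun y => greenKernel F₁ g₁ F₂ g₂ x y * v y) (Set.Ioi x) := fun y hy => by
      simp only [greenKernel, if_neg (not_le.2 (Set.mem_Ioi.1 hy))]; ring
    have i1 := IntegrableOn.congr_fun ((h₁ x).const_mul (F₁ x)) e1 measurableSet_Iic
    have i2 := IntegrableOn.congr_fun ((h₂ x).const_mul (F₂ x)) e2 measurableSet_Ioi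
    rw [← intervalIntegral.integral_Iic_add_Ioi i1 i2, ← setIntegral_congr_fun measurableSet_Iic e1,
      ← setIntegral_congr_fun measurableSet_Ioi e2, integral_const_mul, integral_const_mul]
  have l1 : LocallyIntegrable fun y => g₁ y * v y := fun x =>
    ⟨Set.Iic (x + 1), Iic_mem_nhds (lt_add_one x), h₁ _⟩
  have l2 : LocallyIntegrable fun y => g₂ y * v y := fun x =>
    ⟨Set.Ioi (x - 1), Ioi_mem_nhds (sub_one_lt x), h₂ _⟩
  have P1 : IsPrimitive (fun x => ∫ y in Set.Iic x, g₁ y * v y) fun y => g₁ y * v y :=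
    ⟨l1, fun x => by
      rw [← intervalIntegral.integral_Iic_sub_Iic (h₁ 0) (h₁ x)]; ring⟩
  have P2 : IsPrimitive (fun x => ∫ y in Set.Ioi x, g₂ y * v y) fun y => -1 * (g₂ y * v y) :=
    ⟨l2.smul (-1 : ℂ), fun x => by
      rw [intervalIntegral.integral_const_mul,
        ← intervalIntegral.integral_Ioi_sub_Ioi' (h₂ 0) (h₂ x)]; ring⟩
  -- The product rule also differentiates the limits of integration, which produces the term (f₁g₁ -
  -- f₂g₂)v. For the outgoing kernel it cancels in the solution and is the Wronskian times v in the
  -- flux.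
  have hP := (hf₁.mul P1).add (hf₂.mul P2)
  simp only [key]
  refine hP.congr_ae (Filter.Eventually.of_forall fun x => ?_)
  ring

/-! ### The finite periodic medium -/

section Medium

variable {b₁ b₂ x₂ : ℝ} {k : ℕ}

theorem layerB_pos (hb₁ : 0 < b₁) (hb₂ : 0 < b₂) (n : ℕ) : 0 < layerB b₁ b₂ n := by
  unfold layerB; split_ifs <;> assumption

theorem layerB_two_mul (n : ℕ) : layerB b₁ b₂ (2 * n) = b₂ := by
  simp [layerB]

theorem layerB_two_mul_add_one (n : ℕ) : layerB b₁ b₂ (2 * n + 1) = b₁ := by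
  simp [layerB]

theorem layerX_two_mul (n : ℕ) : layerX x₂ (2 * n) = (n : ℝ) - 1 + x₂ := by
  simp [layerX]

theorem layerX_two_mul_add_one (n : ℕ) : layerX x₂ (2 * n + 1) = n := by
  simp [layerX]

theorem monotone_layerX (hx₀ : 0 < x₂) (hx₁ : x₂ < 1) : Monotone (layerX x₂) := by
  refine monotone_nat_of_le_succ fun n => ?_
  obtain ⟨m, rfl | rfl⟩ := Nat.even_or_odd' n
  · rw [layerX_two_mul, layerX_two_mul_add_one]; linarith
  · rw [show 2 * m + 1 + 1 = 2 * (m + 1) by ring, layerX_two_mul, layerX_two_mul_add_one]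
    push_cast; linarith

theorem coeff_of_mem (hx₁ : x₂ < 1) {j : ℕ} (hj : j < k) {y : ℝ} (h₁ : (j : ℝ) ≤ y)
    (h₂ : y < j + x₂) : coeff b₁ b₂ x₂ k y = (b₂ ^ 2)⁻¹ := by
  have hjk : (j : ℝ) + 1 ≤ k := by exact_mod_cast hj
  have hf : Int.fract y = y - j := by
    rw [Int.fract, Int.floor_eq_iff (z := (j : ℤ)) |>.2 ⟨by simpa using h₁, by push_cast; linarith⟩]
    simp
  have h0 : (0 : ℝ) ≤ j := Nat.cast_nonneg j
  rw [coeff, if_pos ⟨by linarith, by linarith⟩, unitCell, hf, if_pos (by linarith)]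

theorem coeff_of_forall_not {y : ℝ} (h : ∀ j : ℕ, j < k → (j : ℝ) ≤ y → ¬ y < j + x₂) :
    coeff b₁ b₂ x₂ k y = (b₁ ^ 2)⁻¹ := by
  rw [coeff]
  split_ifs with hy
  · have hfl : ⌊y⌋₊ < k := (Nat.floor_lt hy.1).2 hy.2
    have hle : ((⌊y⌋₊ : ℕ) : ℝ) ≤ y := Nat.floor_le hy.1
    have := h _ hfl hle
    have hf : Int.fract y = y - (⌊y⌋₊ : ℕ) := by
      rw [Int.fract, natCast_floor_eq_intCast_floor hy.1]
    rw [unitCell, hf, if_neg (by linarith)]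
  · rfl

theorem coeff_eq_or (y : ℝ) :
    coeff b₁ b₂ x₂ k y = (b₂ ^ 2)⁻¹ ∨ coeff b₁ b₂ x₂ k y = (b₁ ^ 2)⁻¹ := by
  unfold coeff unitCell
  split_ifs <;> simp

theorem coeff_ne_zero (hb₁ : 0 < b₁) (hb₂ : 0 < b₂) (y : ℝ) : coeff b₁ b₂ x₂ k y ≠ 0 := by
  rcases coeff_eq_or (b₁ := b₁) (b₂ := b₂) (x₂ := x₂) (k := k) y with h | h <;> rw [h] <;>
    positivity

theorem abs_inv_coeff_le (y : ℝ) : |(coeff b₁ b₂ x₂ k y)⁻¹| ≤ b₁ ^ 2 + b₂ ^ 2 := by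
  rcases coeff_eq_or (b₁ := b₁) (b₂ := b₂) (x₂ := x₂) (k := k) y with h | h <;>
    rw [h, inv_inv, abs_of_nonneg (sq_nonneg _)]
  · exact le_add_of_nonneg_left (sq_nonneg _)
  · exact le_add_of_nonneg_right (sq_nonneg _)

theorem measurable_coeff : Measurable (coeff b₁ b₂ x₂ k) := by
  unfold coeff unitCell
  refine Measurable.ite ?_ (Measurable.ite ?_ measurable_const measurable_const) measurable_const
  · exact measurableSet_Ici.inter measurableSet_Iio
  · exact measurableSet_lt measurable_fract measurable_const

/-- Induction on the number of cells: a new cell adds the interfaces k and k + x₂, that is, one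
layer with b₂ and a new last layer with b₁. -/
theorem coeff_eq_stepCoeff (hx₁ : x₂ < 1) (y : ℝ) :
    coeff b₁ b₂ x₂ k y = stepCoeff (layerB b₁ b₂) (layerX x₂) (2 * k) y := by
  induction k with
  | zero =>
    have : layerB b₁ b₂ 1 = b₁ := by simp [layerB]
    rw [coeff_of_forall_not (fun j hj => absurd hj (Nat.not_lt_zero j)), Nat.mul_zero, stepCoeff,
      this]
  | succ k ih =>
    rw [show 2 * (k + 1) = 2 * k + 1 + 1 by ring, stepCoeff, stepCoeff, ← ih,
      layerX_two_mul_add_one, show 2 * k + 1 + 1 = 2 * (k + 1) by ring, layerX_two_mul,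
      show 2 * k + 1 + 2 = 2 * (k + 1) + 1 by ring, layerB_two_mul, layerB_two_mul_add_one]
    push_cast
    split_ifs with h1 h2
    · by_cases h : ∃ j : ℕ, j < k ∧ (j : ℝ) ≤ y ∧ y < j + x₂
      · obtain ⟨j, hj, h3, h4⟩ := h
        rw [coeff_of_mem hx₁ hj h3 h4, coeff_of_mem hx₁ (hj.trans (Nat.lt_succ_self k)) h3 h4]
      · push Not at h
        rw [coeff_of_forall_not (k := k) fun j hj h3 => not_lt.2 (h j hj h3),
          coeff_of_forall_not fun j hj h3 => ?_]
        rcases Nat.lt_succ_iff_lt_or_eq.1 hj with hj | rfl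
        · exact not_lt.2 (h j hj h3)
        · exact absurd h3 (not_le.2 h2)
    · exact coeff_of_mem hx₁ (Nat.lt_succ_self k) (not_lt.1 h2) (by linarith)
    · refine coeff_of_forall_not fun j hj h3 => ?_
      have : (j : ℝ) ≤ k := by exact_mod_cast Nat.lt_succ_iff.1 hj
      linarith

/-- The right end of the last layer with coefficient `b₂⁻²`. -/
def rightEnd (x₂ : ℝ) (k : ℕ) : ℝ := (k : ℝ) - 1 + x₂

theorem rightEnd_pos (hx₀ : 0 < x₂) (hk : 1 ≤ k) : 0 < rightEnd x₂ k := by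
  have : (1 : ℝ) ≤ k := by exact_mod_cast hk
  unfold rightEnd; linarith

/-- The medium is symmetric about the midpoint of `[0, k - 1 + x₂]`. -/
theorem coeff_rightEnd_sub (hx₁ : x₂ < 1) :
    (fun y => coeff b₁ b₂ x₂ k (rightEnd x₂ k - y)) =ᵐ[volume] coeff b₁ b₂ x₂ k := by
  -- Reflection sends cell j to cell k - 1 - j but turns [j, j + x₂) into an interval closed on the
  -- other side, so the interfaces, a null set, are excluded.
  have hcount :
      (Set.range (fun j : ℕ => (j : ℝ)) ∪ Set.range fun j : ℕ => (j : ℝ) + x₂).Countable :=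
    (Set.countable_range _).union (Set.countable_range _)
  filter_upwards [hcount.ae_notMem volume] with y hy
  simp only [Set.mem_union, Set.mem_range, not_or, not_exists] at hy
  have hsub : ∀ j : ℕ, j < k → ((k - 1 - j : ℕ) : ℝ) = (k : ℝ) - 1 - j := fun j hj => by
    rw [Nat.cast_sub (by omega), Nat.cast_sub (by omega)]; simp
  by_cases h : ∃ j : ℕ, j < k ∧ (j : ℝ) ≤ y ∧ y < j + x₂
  · obtain ⟨j, hj, h3, h4⟩ := h
    rw [coeff_of_mem hx₁ hj h3 h4]
    have h5 : (j : ℝ) < y := lt_of_le_of_ne h3 (hy.1 j)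
    exact coeff_of_mem hx₁ (j := k - 1 - j) (by omega)
      (by rw [hsub j hj, rightEnd]; linarith) (by rw [hsub j hj, rightEnd]; linarith)
  · push Not at h
    rw [coeff_of_forall_not (y := y) fun j hj h3 => not_lt.2 (h j hj h3)]
    refine coeff_of_forall_not fun j hj h3 h4 => ?_
    have h5 := h (k - 1 - j) (by omega)
    have h6 := hy.2 (k - 1 - j)
    rw [hsub j hj] at h5 h6
    rw [rightEnd] at h3 h4
    exact h6 (le_antisymm (h5 (by linarith)) (by linarith))

/-! ### Jost solutions of the periodic medium and their Wronskian. -/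

variable (b₁ b₂ x₂ k)

/-- The solution equal to `e^{s b₁ y}` on the left of the medium. -/
def jostL (s : ℂ) (y : ℝ) : ℂ := jost (layerB b₁ b₂) (layerX x₂) s (2 * k) y

/-- The flux of `jostL`. -/
def fluxL (s : ℂ) (y : ℝ) : ℂ := jostFlux (layerB b₁ b₂) (layerX x₂) s (2 * k) y

/-- The solution equal to a multiple of `e^{-s b₁ y}` on the right of the medium. -/
def jostR (s : ℂ) (y : ℝ) : ℂ := jostL b₁ b₂ x₂ k s (rightEnd x₂ k - y)

/-- The flux of `jostR`. -/
def fluxR (s : ℂ) (y : ℝ) : ℂ := -fluxL b₁ b₂ x₂ k s (rightEnd x₂ k - y)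

/-- The normalization of `jostL` on the right of the medium. -/
def rightNorm : ℝ := layerNorm (layerB b₁ b₂) (2 * k)

/-- The Wronskian of `jostL` and `jostR`. -/
def wronskian (s : ℂ) : ℂ :=
  -2 * (s / b₁) * rightNorm b₁ b₂ k * exp (s * b₁ * rightEnd x₂ k) *
    detD b₁ b₂ x₂ (2 * k + 1) s

variable {b₁ b₂ x₂ k}

/-- For k = 0 this fails: `detPair` has the default value 0 at index 1, while `layerPair` starts at
(-1, 0). -/
theorem layerPair_two_mul (hk : 1 ≤ k) (s : ℂ) :
    layerPair (layerB b₁ b₂) (layerX x₂) s (2 * k) =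
      (detD b₁ b₂ x₂ (2 * k + 1) s, detDtilde b₁ b₂ x₂ (2 * k + 1) s) := by
  obtain ⟨m, rfl⟩ : ∃ m, k = m + 1 := ⟨k - 1, by omega⟩
  rw [show 2 * (m + 1) = (2 * m + 1) + 1 by ring, layerPair_succ_eq_detPair]
  rfl

theorem rightNorm_ne_zero (hb₁ : 0 < b₁) (hb₂ : 0 < b₂) : (rightNorm b₁ b₂ k : ℂ) ≠ 0 :=
  ofReal_ne_zero.2 (layerNorm_ne_zero (layerB_pos hb₁ hb₂) _)

theorem differentiable_detD (hk : 1 ≤ k) :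
    Differentiable ℂ (detD b₁ b₂ x₂ (2 * k + 1)) ∧
      Differentiable ℂ (detDtilde b₁ b₂ x₂ (2 * k + 1)) := by
  have := differentiable_layerPair (b := layerB b₁ b₂) (x := layerX x₂) (2 * k)
  simpa only [layerPair_two_mul hk] using this

theorem detD_ne_zero (hb₁ : 0 < b₁) (hb₂ : 0 < b₂) (hx₀ : 0 < x₂) (hx₁ : x₂ < 1) (hk : 1 ≤ k)
    {s : ℂ} (hs : 0 ≤ s.re) : detD b₁ b₂ x₂ (2 * k + 1) s ≠ 0 := by
  have := layerPair_fst_ne_zero s (layerB_pos hb₁ hb₂) (monotone_layerX hx₀ hx₁) hs (2 * k)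
  rwa [layerPair_two_mul hk] at this

theorem detDtilde_ne_zero_of_detD_eq_zero (hb₁ : 0 < b₁) (hb₂ : 0 < b₂) (hk : 1 ≤ k)
    {s : ℂ} (h : detD b₁ b₂ x₂ (2 * k + 1) s = 0) : detDtilde b₁ b₂ x₂ (2 * k + 1) s ≠ 0 := by
  intro h'
  have := layerPair_ne_zero (x := layerX x₂) s (layerB_pos hb₁ hb₂) (2 * k)
  rw [layerPair_two_mul hk] at this
  exact this ⟨h, h'⟩

theorem isSolution_jostL (hb₁ : 0 < b₁) (hb₂ : 0 < b₂) (hx₀ : 0 < x₂) (hx₁ : x₂ < 1) (s : ℂ) :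
    IsSolution (coeff b₁ b₂ x₂ k) s (jostL b₁ b₂ x₂ k s) (fluxL b₁ b₂ x₂ k s) :=
  (isSolution_jost s (layerB_pos hb₁ hb₂) (monotone_layerX hx₀ hx₁) (2 * k)).congr_coeff
    (Filter.Eventually.of_forall fun y => (coeff_eq_stepCoeff hx₁ y).symm)

theorem isSolution_jostR (hb₁ : 0 < b₁) (hb₂ : 0 < b₂) (hx₀ : 0 < x₂) (hx₁ : x₂ < 1) (s : ℂ) :
    IsSolution (coeff b₁ b₂ x₂ k) s (jostR b₁ b₂ x₂ k s) (fluxR b₁ b₂ x₂ k s) :=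
  ((isSolution_jostL hb₁ hb₂ hx₀ hx₁ s).comp_sub_left (rightEnd x₂ k)).congr_coeff
    (coeff_rightEnd_sub hx₁)

theorem jostL_of_neg (hx₀ : 0 < x₂) (hx₁ : x₂ < 1) (s : ℂ) {y : ℝ} (hy : y < 0) :
    jostL b₁ b₂ x₂ k s y = exp (s * b₁ * y) := by
  rw [jostL, jost_of_lt s (monotone_layerX hx₀ hx₁) _ (by simpa [layerX] using hy), layerSol]
  simp [layerNorm, layerPair, layerB]

theorem fluxL_of_neg (hx₀ : 0 < x₂) (hx₁ : x₂ < 1) (s : ℂ) {y : ℝ} (hy : y < 0) :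
    fluxL b₁ b₂ x₂ k s y = s / b₁ * exp (s * b₁ * y) := by
  rw [fluxL, jostFlux_of_lt s (monotone_layerX hx₀ hx₁) _ (by simpa [layerX] using hy), layerFlux]
  simp [layerNorm, layerPair, layerB]

theorem jostL_of_le (hk : 1 ≤ k) (s : ℂ) {y : ℝ} (hy : rightEnd x₂ k ≤ y) :
    jostL b₁ b₂ x₂ k s y = rightNorm b₁ b₂ k *
      (detD b₁ b₂ x₂ (2 * k + 1) s * exp (s * b₁ * y) -
        detDtilde b₁ b₂ x₂ (2 * k + 1) s * exp (-s * b₁ * y)) := by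
  rw [jostL, jost_of_le s _ (by rwa [layerX_two_mul]), layerSol, layerPair_two_mul hk,
    layerB_two_mul_add_one, rightNorm]

theorem fluxL_of_le (hk : 1 ≤ k) (s : ℂ) {y : ℝ} (hy : rightEnd x₂ k ≤ y) :
    fluxL b₁ b₂ x₂ k s y = rightNorm b₁ b₂ k * (s / b₁) *
      (detD b₁ b₂ x₂ (2 * k + 1) s * exp (s * b₁ * y) +
        detDtilde b₁ b₂ x₂ (2 * k + 1) s * exp (-s * b₁ * y)) := by
  rw [fluxL, jostFlux_of_le s _ (by rwa [layerX_two_mul]), layerFlux, layerPair_two_mul hk,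
    layerB_two_mul_add_one, rightNorm]

theorem jostR_of_lt (hx₀ : 0 < x₂) (hx₁ : x₂ < 1) (s : ℂ) {y : ℝ} (hy : rightEnd x₂ k < y) :
    jostR b₁ b₂ x₂ k s y = exp (s * b₁ * rightEnd x₂ k) * exp (-s * b₁ * y) := by
  rw [jostR, jostL_of_neg hx₀ hx₁ s (by linarith), ← exp_add]
  congr 1; push_cast; ring

theorem fluxR_of_lt (hx₀ : 0 < x₂) (hx₁ : x₂ < 1) (s : ℂ) {y : ℝ} (hy : rightEnd x₂ k < y) :
    fluxR b₁ b₂ x₂ k s y =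
      -(s / b₁ * (exp (s * b₁ * rightEnd x₂ k) * exp (-s * b₁ * y))) := by
  rw [fluxR, fluxL_of_neg hx₀ hx₁ s (by linarith), ← exp_add]
  congr 3; push_cast; ring

theorem jostR_of_neg (hk : 1 ≤ k) (s : ℂ) {y : ℝ} (hy : y < 0) :
    jostR b₁ b₂ x₂ k s y = rightNorm b₁ b₂ k *
      (detD b₁ b₂ x₂ (2 * k + 1) s * exp (s * b₁ * rightEnd x₂ k) * exp (-s * b₁ * y) -
        detDtilde b₁ b₂ x₂ (2 * k + 1) s * exp (-s * b₁ * rightEnd x₂ k) * exp (s * b₁ * y)) := by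
  rw [jostR, jostL_of_le hk s (by linarith)]
  rw [show s * b₁ * ((rightEnd x₂ k - y : ℝ) : ℂ) = s * b₁ * rightEnd x₂ k + -s * b₁ * y by
      push_cast; ring,
    show -s * b₁ * ((rightEnd x₂ k - y : ℝ) : ℂ) = -s * b₁ * rightEnd x₂ k + s * b₁ * y by
      push_cast; ring, exp_add, exp_add]
  ring

/-- The Wronskian is constant, so it may be computed right of the medium. There `jostR` is a single
exponential, and the det D̃ terms cancel. -/
theorem wronskian_eq (hb₁ : 0 < b₁) (hb₂ : 0 < b₂) (hx₀ : 0 < x₂) (hx₁ : x₂ < 1) (hk : 1 ≤ k)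
    (s : ℂ) (y : ℝ) :
    jostL b₁ b₂ x₂ k s y * fluxR b₁ b₂ x₂ k s y - jostR b₁ b₂ x₂ k s y * fluxL b₁ b₂ x₂ k s y =
      wronskian b₁ b₂ x₂ k s := by
  have hlt : rightEnd x₂ k < rightEnd x₂ k + 1 := lt_add_one _
  rw [(isSolution_jostL hb₁ hb₂ hx₀ hx₁ s).wronskian_eq (isSolution_jostR hb₁ hb₂ hx₀ hx₁ s) y
    (rightEnd x₂ k + 1), jostL_of_le hk s hlt.le, fluxL_of_le hk s hlt.le,
    jostR_of_lt hx₀ hx₁ s hlt, fluxR_of_lt hx₀ hx₁ s hlt, wronskian]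
  have e : exp (s * b₁ * ((rightEnd x₂ k + 1 : ℝ) : ℂ)) *
      exp (-s * b₁ * ((rightEnd x₂ k + 1 : ℝ) : ℂ)) = 1 := by
    rw [← exp_add, ← exp_zero]; congr 1; ring
  linear_combination (-2 * (s / b₁) * rightNorm b₁ b₂ k * exp (s * b₁ * rightEnd x₂ k) *
    detD b₁ b₂ x₂ (2 * k + 1) s) * e

theorem wronskian_ne_zero_iff (hb₁ : 0 < b₁) (hb₂ : 0 < b₂) {s : ℂ} (hs : s ≠ 0) :
    wronskian b₁ b₂ x₂ k s ≠ 0 ↔ detD b₁ b₂ x₂ (2 * k + 1) s ≠ 0 := by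
  have h1 : (b₁ : ℂ) ≠ 0 := ofReal_ne_zero.2 hb₁.ne'
  simp [wronskian, hs, h1, rightNorm_ne_zero hb₁ hb₂]

theorem differentiable_wronskian (hk : 1 ≤ k) :
    Differentiable ℂ (wronskian b₁ b₂ x₂ k) := by
  have := (differentiable_detD (b₁ := b₁) (b₂ := b₂) (x₂ := x₂) hk).1
  unfold wronskian
  fun_prop

/-! ### Growth of the Jost solutions -/

/-- On the left the bound is an identity, on [0, L] it is compactness together with e^{κy} ≥ 1, and
on the right the decaying exponential is dominated by the growing one. -/
theorem expBound_of_exp {f : ℝ → ℂ} (hf : Continuous f) {c A B B' : ℂ} (hc : 0 < c.re) {L : ℝ}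
    (h₁ : ∀ y < 0, f y = A * exp (c * y))
    (h₂ : ∀ y, L ≤ y → f y = B * exp (c * y) + B' * exp (-c * y)) : ExpBound c.re f := by
  obtain ⟨M, hM⟩ := (isCompact_Icc (a := (0 : ℝ)) (b := L)).exists_bound_of_continuousOn
    hf.continuousOn
  refine ⟨‖A‖ + ‖B‖ + ‖B'‖ + |M|, by positivity, fun y => ?_⟩
  have hexp : ∀ c : ℂ, ‖exp (c * y)‖ = Real.exp (c.re * y) := fun c => by
    rw [norm_exp]; simp
  have hE := Real.exp_pos (c.re * y)
  rcases lt_or_ge y 0 with hy | hy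
  · rw [h₁ y hy, norm_mul, hexp]
    gcongr
    linarith [norm_nonneg B, norm_nonneg B', abs_nonneg M]
  have hE1 : 1 ≤ Real.exp (c.re * y) := Real.one_le_exp (by positivity)
  rcases le_or_gt L y with hy' | hy'
  · rw [h₂ y hy']
    have hE2 : Real.exp ((-c).re * y) ≤ Real.exp (c.re * y) := by
      apply Real.exp_le_exp.2
      rw [neg_re]; nlinarith
    calc ‖B * exp (c * y) + B' * exp (-c * y)‖
        ≤ ‖B‖ * Real.exp (c.re * y) + ‖B'‖ * Real.exp (c.re * y) := by
          refine (norm_add_le _ _).trans ?_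
          rw [norm_mul, norm_mul, hexp, hexp]
          gcongr
      _ = (‖B‖ + ‖B'‖) * Real.exp (c.re * y) := by ring
      _ ≤ _ := by
          refine mul_le_mul_of_nonneg_right ?_ hE.le
          linarith [norm_nonneg A, abs_nonneg M]
  · refine (hM y ⟨hy, hy'.le⟩).trans ?_
    have : M ≤ ‖A‖ + ‖B‖ + ‖B'‖ + |M| := by
      linarith [norm_nonneg A, norm_nonneg B, norm_nonneg B', le_abs_self M]
    nlinarith [norm_nonneg A, norm_nonneg B, norm_nonneg B', abs_nonneg M]

theorem ExpBound.comp_sub_left {κ : ℝ} {f : ℝ → ℂ} (h : ExpBound κ f) (L : ℝ) :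
    ExpBound (-κ) fun y => f (L - y) := by
  obtain ⟨C, hC, hf⟩ := h
  refine ⟨C * Real.exp (κ * L), by positivity, fun y => (hf _).trans (le_of_eq ?_)⟩
  rw [mul_assoc, ← Real.exp_add]
  congr 2; ring

theorem ExpBound.mul_left {κ : ℝ} {f : ℝ → ℂ} (h : ExpBound κ f) {m : ℝ → ℂ} {M : ℝ}
    (hm : ∀ y, ‖m y‖ ≤ M) : ExpBound κ fun y => m y * f y := by
  obtain ⟨C, hC, hf⟩ := h
  have hM : 0 ≤ M := (norm_nonneg _).trans (hm 0)
  refine ⟨M * C, by positivity, fun y => ?_⟩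
  rw [norm_mul, mul_assoc]
  exact mul_le_mul (hm y) (hf y) (norm_nonneg _) hM

theorem expBound_jostL (hb₁ : 0 < b₁) (hb₂ : 0 < b₂) (hx₀ : 0 < x₂) (hx₁ : x₂ < 1) (hk : 1 ≤ k)
    {s : ℂ} (hs : 0 < s.re) :
    ExpBound (s * b₁).re (jostL b₁ b₂ x₂ k s) ∧ ExpBound (s * b₁).re (fluxL b₁ b₂ x₂ k s) := by
  have hsol := isSolution_jostL (k := k) hb₁ hb₂ hx₀ hx₁ s
  have hre : 0 < (s * b₁).re := by
    simpa using mul_pos hs hb₁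
  constructor
  · refine expBound_of_exp hsol.left.continuous (A := 1) hre (L := rightEnd x₂ k)
      (B := rightNorm b₁ b₂ k * detD b₁ b₂ x₂ (2 * k + 1) s)
      (B' := -(rightNorm b₁ b₂ k * detDtilde b₁ b₂ x₂ (2 * k + 1) s))
      (fun y hy => by rw [jostL_of_neg hx₀ hx₁ s hy, one_mul]) fun y hy => ?_
    rw [jostL_of_le hk s hy, neg_mul s]; ring
  · refine expBound_of_exp hsol.right.continuous (A := s / b₁) hre (L := rightEnd x₂ k)
      (B := rightNorm b₁ b₂ k * (s / b₁) * detD b₁ b₂ x₂ (2 * k + 1) s)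
      (B' := rightNorm b₁ b₂ k * (s / b₁) * detDtilde b₁ b₂ x₂ (2 * k + 1) s)
      (fun y hy => fluxL_of_neg hx₀ hx₁ s hy) fun y hy => ?_
    rw [fluxL_of_le hk s hy, neg_mul s]; ring

theorem expBound_jostR (hb₁ : 0 < b₁) (hb₂ : 0 < b₂) (hx₀ : 0 < x₂) (hx₁ : x₂ < 1) (hk : 1 ≤ k)
    {s : ℂ} (hs : 0 < s.re) :
    ExpBound (-(s * b₁).re) (jostR b₁ b₂ x₂ k s) ∧
      ExpBound (-(s * b₁).re) (fluxR b₁ b₂ x₂ k s) := by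
  obtain ⟨h1, h2⟩ := expBound_jostL hb₁ hb₂ hx₀ hx₁ hk hs
  refine ⟨h1.comp_sub_left _, ?_⟩
  have h3 := (h2.comp_sub_left (rightEnd x₂ k)).mul_left (m := fun _ => -1) (M := 1) (by simp)
  simp only [neg_mul, one_mul] at h3
  exact h3

theorem isEntireFamily_jostL {S : Set ℝ} (hS : MeasurableSet S) (hbd : Bornology.IsBounded S) :
    IsEntireFamily fun s => S.indicator (jostL b₁ b₂ x₂ k s) :=
  isEntireFamily_jost (2 * k) hS hbd

theorem isEntireFamily_jostR {S : Set ℝ} (hS : MeasurableSet S) (hbd : Bornology.IsBounded S) :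
    IsEntireFamily fun s => S.indicator (jostR b₁ b₂ x₂ k s) := by
  set T : Set ℝ := (fun y => rightEnd x₂ k - y) ⁻¹' S with hT
  have hTm : MeasurableSet T := (measurable_const.sub measurable_id) hS
  have hTb : Bornology.IsBounded T := by
    obtain ⟨R, hR⟩ := hbd.exists_norm_le
    refine (Metric.isBounded_closedBall (x := rightEnd x₂ k) (r := R)).subset fun y hy => ?_
    have := hR _ hy
    rwa [Metric.mem_closedBall, dist_comm, Real.dist_eq]
  refine ((isEntireFamily_jostL (b₁ := b₁) (b₂ := b₂) (x₂ := x₂) (k := k) hTm hTb).comp_sub_left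
    (rightEnd x₂ k)).congr fun s y => ?_
  have hiff : rightEnd x₂ k - y ∈ T ↔ y ∈ S := by simp [hT]
  by_cases hy : y ∈ S
  · rw [Set.indicator_of_mem hy, Set.indicator_of_mem (hiff.2 hy), jostR]
  · rw [Set.indicator_of_notMem hy, Set.indicator_of_notMem (fun h => hy (hiff.1 h))]

end Medium

/-! ### The resolvent in the upper half-plane -/

section Resolvent

variable {b₁ b₂ x₂ : ℝ} {k : ℕ}

/-- Multiply by e^{-cy}: f e^{-cy} is integrable by Cauchy–Schwarz and so is E e^{-2cy}. This leaves
the constant A integrable on a half-line. -/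
theorem eq_zero_of_memLp_exp {f : ℝ → ℂ} (hf : MemLp f 2 volume) {c A E : ℂ} (hc : 0 < c.re)
    {L : ℝ} (h : ∀ y, L < y → f y = A * exp (c * y) + E * exp (-c * y)) : A = 0 := by
  have hexp : ∀ (c : ℂ) (y : ℝ), ‖exp (c * y)‖ = Real.exp (c.re * y) := fun c y => by
    rw [norm_exp]; simp
  have hb : ExpBound (-c.re) fun y => exp (-c * y) :=
    ⟨1, zero_le_one, fun y => by rw [hexp, one_mul, neg_re]⟩
  have h1 := hb.integrableOn_mul_Ioi hc (by fun_prop) hf L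
  have h2 := (integrableOn_exp_mul_complex_Ioi (a := -2 * c) (by simpa using hc) L).const_mul E
  have h3 : IntegrableOn (fun _ : ℝ => A) (Set.Ioi L) := by
    refine IntegrableOn.congr_fun (h1.sub h2) (fun y hy => ?_) measurableSet_Ioi
    have e1 : exp (-c * y) * exp (c * y) = 1 := by
      rw [← exp_add, ← exp_zero]; congr 1; ring
    have e2 : exp (-c * y) * exp (-c * y) = exp (-2 * c * y) := by
      rw [← exp_add]; congr 1; ring
    simp only [Pi.sub_apply]
    rw [h y hy]
    linear_combination A * e1 + E * e2
  rw [integrableOn_const_iff (by simp)] at h3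
  simpa using h3

theorem coeff_jostL_eq_zero_of_memLp (hb₁ : 0 < b₁) (hb₂ : 0 < b₂) (hx₀ : 0 < x₂) (hx₁ : x₂ < 1)
    (hk : 1 ≤ k) {s : ℂ} (hs : 0 < s.re) {f : ℝ → ℂ} (hf : MemLp f 2 volume) {α β : ℂ}
    (h : ∀ y, f y = α * jostL b₁ b₂ x₂ k s y + β * jostR b₁ b₂ x₂ k s y) : α = 0 := by
  have hre : 0 < (s * b₁).re := by simpa using mul_pos hs hb₁
  have := eq_zero_of_memLp_exp hf hre (L := rightEnd x₂ k)
    (A := α * (rightNorm b₁ b₂ k * detD b₁ b₂ x₂ (2 * k + 1) s))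
    (E := β * exp (s * b₁ * rightEnd x₂ k) -
      α * (rightNorm b₁ b₂ k * detDtilde b₁ b₂ x₂ (2 * k + 1) s)) fun y hy => by
    rw [h y, jostL_of_le hk s hy.le, jostR_of_lt hx₀ hx₁ s hy, neg_mul s]; ring
  exact (mul_eq_zero.1 this).resolve_right (mul_ne_zero (rightNorm_ne_zero hb₁ hb₂)
    (detD_ne_zero hb₁ hb₂ hx₀ hx₁ hk hs.le))

/-- There are no nonzero square-integrable solutions of the homogeneous equation. -/
theorem eq_zero_of_weak_solution (hb₁ : 0 < b₁) (hb₂ : 0 < b₂) (hx₀ : 0 < x₂) (hx₁ : x₂ < 1)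
    (hk : 1 ≤ k) {s : ℂ} (hs : 0 < s.re) {u w : ℝ → ℂ} (hu : MemLp u 2 volume)
    (h₁ : HasWeakDeriv u w)
    (h₂ : HasWeakDeriv (fun x => (coeff b₁ b₂ x₂ k x : ℂ) * w x) fun x => s ^ 2 * u x) :
    u =ᵐ[volume] 0 := by
  obtain ⟨Ψ, P, hΨ, hsol⟩ := exists_isSolution_of_hasWeakDeriv (coeff_ne_zero hb₁ hb₂) h₁ h₂
  have hs0 : s ≠ 0 := fun h => by simp [h] at hs
  have hW := (wronskian_ne_zero_iff (x₂ := x₂) (k := k) hb₁ hb₂ hs0).2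
    (detD_ne_zero hb₁ hb₂ hx₀ hx₁ hk hs.le)
  obtain ⟨α, β, hαβ⟩ := hsol.exists_combination (isSolution_jostL hb₁ hb₂ hx₀ hx₁ s)
    (isSolution_jostR hb₁ hb₂ hx₀ hx₁ s) hW (wronskian_eq hb₁ hb₂ hx₀ hx₁ hk s)
  have hΨ2 : MemLp Ψ 2 volume := (memLp_congr_ae hΨ).1 hu
  have hα : α = 0 := coeff_jostL_eq_zero_of_memLp hb₁ hb₂ hx₀ hx₁ hk hs hΨ2 hαβ
  have hΨ2' : MemLp (fun y => Ψ (rightEnd x₂ k - y)) 2 volume :=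
    hΨ2.comp_measurePreserving (volume.measurePreserving_sub_left (rightEnd x₂ k))
  -- Reflection about L/2 interchanges `jostL` and `jostR`, so the argument for α applies to β.
  have hβ : β = 0 := coeff_jostL_eq_zero_of_memLp hb₁ hb₂ hx₀ hx₁ hk hs hΨ2' (β := α)
    fun y => by
      rw [hαβ, jostR, jostR, sub_sub_cancel]; ring
  filter_upwards [hΨ] with x hx
  rw [hx, hαβ, hα, hβ]; simp

/-- The kernel of the (unnormalized) outgoing Green operator. -/
def outgoingKernel (b₁ b₂ x₂ : ℝ) (k : ℕ) (s : ℂ) : ℝ → ℝ → ℂ :=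
  greenKernel (jostR b₁ b₂ x₂ k s) (jostL b₁ b₂ x₂ k s) (jostL b₁ b₂ x₂ k s) (jostR b₁ b₂ x₂ k s)

theorem operatorGraph_sub {u f u' f' : L2} (h : OperatorGraph b₁ b₂ x₂ k u f)
    (h' : OperatorGraph b₁ b₂ x₂ k u' f') : OperatorGraph b₁ b₂ x₂ k (u - u') (f - f') := by
  obtain ⟨w, h1, h2⟩ := h
  obtain ⟨w', h1', h2'⟩ := h'
  refine ⟨w - w', (h1.sub h1').congr_ae (Lp.coeFn_sub u u').symm (Lp.coeFn_sub w w').symm,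
    (h2.sub h2').congr_ae ?_ ?_⟩
  · filter_upwards [Lp.coeFn_sub w w'] with x hx
    rw [hx, Pi.sub_apply]; ring
  · filter_upwards [Lp.coeFn_sub f f'] with x hx
    rw [hx, Pi.sub_apply]; ring

/-- Variation of constants: one outgoing solution decays at each end, so their Green kernel passes
the Schur test. Uniqueness comes from the absence of nonzero square-integrable homogeneous
solutions. -/
theorem exists_resolvent (hb₁ : 0 < b₁) (hb₂ : 0 < b₂) (hx₀ : 0 < x₂) (hx₁ : x₂ < 1)
    (hk : 1 ≤ k) {z : ℂ} (hz : 0 < z.im) :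
    ∃ R : L2 →L[ℂ] L2, IsResolventAt b₁ b₂ x₂ k z R ∧ ∀ v : L2, R v =ᵐ[volume] fun x =>
      -(wronskian b₁ b₂ x₂ k (-I * z))⁻¹ * ∫ y, outgoingKernel b₁ b₂ x₂ k (-I * z) x y * v y := by
  set s : ℂ := -I * z with hsz
  have hs : 0 < s.re := by simpa [hsz] using hz
  have hs2 : s ^ 2 = -z ^ 2 := by rw [hsz, mul_pow, neg_sq, I_sq]; ring
  have hs0 : s ≠ 0 := fun h => by simp [h] at hs
  have hW := (wronskian_ne_zero_iff (x₂ := x₂) (k := k) hb₁ hb₂ hs0).2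
    (detD_ne_zero hb₁ hb₂ hx₀ hx₁ hk hs.le)
  set W := wronskian b₁ b₂ x₂ k s with hWdef
  set a := coeff b₁ b₂ x₂ k with ha
  set θL := jostL b₁ b₂ x₂ k s with hθL
  set θR := jostR b₁ b₂ x₂ k s with hθR
  set pL := fluxL b₁ b₂ x₂ k s with hpL
  set pR := fluxR b₁ b₂ x₂ k s with hpR
  have hκ : 0 < (s * b₁).re := by simpa using mul_pos hs hb₁
  have solL : IsSolution a s θL pL := isSolution_jostL hb₁ hb₂ hx₀ hx₁ s
  have solR : IsSolution a s θR pR := isSolution_jostR hb₁ hb₂ hx₀ hx₁ s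
  obtain ⟨eL, eL'⟩ := expBound_jostL (k := k) hb₁ hb₂ hx₀ hx₁ hk hs
  obtain ⟨eR, eR'⟩ := expBound_jostR (k := k) hb₁ hb₂ hx₀ hx₁ hk hs
  have mL : Measurable θL := solL.left.continuous.measurable
  have mR : Measurable θR := solR.left.continuous.measurable
  have ma : Measurable fun x => (a x : ℂ)⁻¹ :=
    (measurable_ofReal.comp (measurable_coeff (b₁ := b₁) (b₂ := b₂) (x₂ := x₂) (k := k))).inv
  have ba : ∀ x, ‖(a x : ℂ)⁻¹‖ ≤ b₁ ^ 2 + b₂ ^ 2 := fun x => by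
    rw [← ofReal_inv, norm_real]; exact abs_inv_coeff_le x
  obtain ⟨C, hK⟩ := exists_isSchurKernel_green hκ mR mL mL mR eR eL eL eR
  -- This second kernel, built from a⁻¹ times the fluxes, represents the weak derivative and places
  -- it in L².
  obtain ⟨C', hK'⟩ := exists_isSchurKernel_green hκ
    (ma.mul solR.right.continuous.measurable) mL
    (ma.mul solL.right.continuous.measurable) mR (eR'.mul_left ba) eL (eL'.mul_left ba) eR
  have hRv : ∀ v : L2, ((-W⁻¹) • hK.op) v =ᵐ[volume] fun x =>
      -W⁻¹ * ∫ y, greenKernel θR θL θL θR x y * v y := fun v => by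
    rw [smul_apply]
    filter_upwards [Lp.coeFn_smul (-W⁻¹) (hK.op v), hK.coeFn_op v] with x h1 h2
    rw [h1, Pi.smul_apply, h2, smul_eq_mul]
  have hgraph : ∀ v : L2, OperatorGraph b₁ b₂ x₂ k (((-W⁻¹) • hK.op) v)
      (z ^ 2 • (((-W⁻¹) • hK.op) v) + v) := by
    intro v
    have i1 := eL.integrableOn_mul_Iic hκ mL (Lp.memLp v)
    have i2 := eR.integrableOn_mul_Ioi hκ mR (Lp.memLp v)
    have P1 := (isPrimitive_green solR.left solL.left i1 i2).const_mul (-W⁻¹)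
    have P2 := (isPrimitive_green solR.right solL.right i1 i2).const_mul (-W⁻¹)
    have hw : (-W⁻¹ • hK'.op v : L2) =ᵐ[volume] fun x => -W⁻¹ * ∫ y, greenKernel
        (fun x => (a x : ℂ)⁻¹ * pR x) θL (fun x => (a x : ℂ)⁻¹ * pL x) θR x y * v y := by
      filter_upwards [Lp.coeFn_smul (-W⁻¹) (hK'.op v), hK'.coeFn_op v] with x h1 h2
      rw [h1, Pi.smul_apply, h2, smul_eq_mul]; rfl
    refine ⟨-W⁻¹ • hK'.op v, P1.hasWeakDeriv.congr_ae (hRv v).symm ?_,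
      P2.hasWeakDeriv.congr_ae ?_ ?_⟩
    · filter_upwards [hw] with x hx
      rw [hx]; ring
    · filter_upwards [hw] with x hx
      have e : ∫ y, greenKernel (fun x => (a x : ℂ)⁻¹ * pR x) θL
          (fun x => (a x : ℂ)⁻¹ * pL x) θR x y * v y =
          (a x : ℂ)⁻¹ * ∫ y, greenKernel pR θL pL θR x y * v y := by
        rw [← integral_const_mul]
        congr 1; funext y
        unfold greenKernel
        split_ifs <;> ring
      have hax : (a x : ℂ) ≠ 0 := ofReal_ne_zero.2 (coeff_ne_zero hb₁ hb₂ x)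
      rw [hx, e, ← ha]
      field_simp
    · filter_upwards [hRv v, Lp.coeFn_add (z ^ 2 • (((-W⁻¹) • hK.op) v)) v,
        Lp.coeFn_smul (z ^ 2) (((-W⁻¹) • hK.op) v)] with x h1 h2 h3
      have e : ∫ y, greenKernel (fun x => s ^ 2 * θR x) θL (fun x => s ^ 2 * θL x) θR x y * v y =
          s ^ 2 * ∫ y, greenKernel θR θL θL θR x y * v y := by
        rw [← integral_const_mul]
        congr 1; funext y
        unfold greenKernel
        split_ifs <;> ring
      -- This is the jump of the flux kernel on the diagonal. The factor -W⁻¹ turns it into the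
      -- source term -v of (au')' = s²u - v.
      have hWx : pR x * θL x - pL x * θR x = W := by
        rw [hWdef, ← wronskian_eq hb₁ hb₂ hx₀ hx₁ hk s x]; ring
      rw [h2, Pi.add_apply, h3, Pi.smul_apply, h1, e, hWx, hs2, smul_eq_mul]
      field_simp
  refine ⟨(-W⁻¹) • hK.op, fun u v => ⟨fun h => h ▸ hgraph v, fun h => ?_⟩, hRv⟩
  obtain ⟨w, g1, g2⟩ := operatorGraph_sub (hgraph v) h
  have g3 : ((-W⁻¹) • hK.op) v - u =ᵐ[volume] 0 := by
    refine eq_zero_of_weak_solution hb₁ hb₂ hx₀ hx₁ hk hs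
      (Lp.memLp (((-W⁻¹) • hK.op) v - u)) g1 (g2.congr_ae (Filter.EventuallyEq.refl _ _) ?_)
    · have e : z ^ 2 • (((-W⁻¹) • hK.op) v) + v - (z ^ 2 • u + v) =
          z ^ 2 • ((((-W⁻¹) • hK.op) v) - u) := by
        rw [smul_sub]; abel
      rw [e]
      filter_upwards [Lp.coeFn_smul (z ^ 2) ((((-W⁻¹) • hK.op) v) - u)] with x hx
      rw [hx, Pi.smul_apply, hs2, smul_eq_mul, neg_mul]
  apply Lp.ext
  filter_upwards [g3, Lp.coeFn_sub (((-W⁻¹) • hK.op) v) u] with x h1 h2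
  rw [h2] at h1
  exact sub_eq_zero.1 h1

theorem IsResolventAt.unique {z : ℂ} {R R' : L2 →L[ℂ] L2} (h : IsResolventAt b₁ b₂ x₂ k z R)
    (h' : IsResolventAt b₁ b₂ x₂ k z R') : R = R' := by
  ext1 v
  exact (h (R' v) v).2 ((h' (R' v) v).1 rfl)

end Resolvent

/-! ### Meromorphic continuation of the cut-off resolvent -/

section Continuation

variable {b₁ b₂ x₂ : ℝ} {k : ℕ}

/-- With χ the indicator of the window, this covers the s-independent kernels χ(x)χ(y) restricted to
y ≤ x or to x < y. They live where |x - y| ≤ 2N. -/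
theorem exists_isSchurKernel_window (N : ℝ) {f₁ g₁ f₂ g₂ : ℝ → ℂ}
    (h : ∀ f ∈ ({f₁, g₁, f₂, g₂} : Set (ℝ → ℂ)), f = 0 ∨
      f = (Set.Icc (-N) N).indicator fun _ => 1) :
    ∃ C, IsSchurKernel (greenKernel f₁ g₁ f₂ g₂) C := by
  have hm : ∀ f ∈ ({f₁, g₁, f₂, g₂} : Set (ℝ → ℂ)), Measurable f := fun f hf => by
    rcases h f hf with rfl | rfl
    · exact measurable_const
    · exact measurable_const.indicator measurableSet_Icc
  have hle : ∀ f ∈ ({f₁, g₁, f₂, g₂} : Set (ℝ → ℂ)), ∀ x, ‖f x‖ ≤ 1 ∧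
      (x ∉ Set.Icc (-N) N → f x = 0) := fun f hf x => by
    rcases h f hf with rfl | rfl
    · simp
    · by_cases hx : x ∈ Set.Icc (-N) N
      · simp [hx]
      · rw [Set.indicator_of_notMem hx]; simp
  have key : ∀ f ∈ ({f₁, g₁, f₂, g₂} : Set (ℝ → ℂ)), ∀ g ∈ ({f₁, g₁, f₂, g₂} : Set (ℝ → ℂ)),
      ∀ x y, ‖f x * g y‖ ≤ (Set.Icc (-(2 * N)) (2 * N)).indicator (fun _ => (1 : ℝ)) (x - y) := by
    intro f hf g hg x y
    by_cases hxy : x - y ∈ Set.Icc (-(2 * N)) (2 * N)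
    · rw [Set.indicator_of_mem hxy, norm_mul]
      exact mul_le_one₀ (hle f hf x).1 (norm_nonneg _) (hle g hg y).1
    · rw [Set.indicator_of_notMem hxy]
      by_cases hx : x ∈ Set.Icc (-N) N
      · rw [(hle g hg y).2 fun hy => hxy ⟨by linarith [hx.1, hy.2], by linarith [hx.2, hy.1]⟩]
        simp
      · rw [(hle f hf x).2 hx]
        simp
  have hi : Integrable ((Set.Icc (-(2 * N)) (2 * N)).indicator fun _ => (1 : ℝ)) :=
    (integrable_indicator_iff measurableSet_Icc).2 (integrableOn_const (by simp))
  refine ⟨_, isSchurKernel_of_le (measurable_greenKernel (hm _ (by simp)) (hm _ (by simp))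
    (hm _ (by simp)) (hm _ (by simp))) hi fun x y => ?_⟩
  unfold greenKernel
  split_ifs
  · exact key _ (by simp) _ (by simp) x y
  · exact key _ (by simp) _ (by simp) x y

/-- The cut-off outgoing Green operators depend holomorphically on the spectral parameter. -/
theorem exists_differentiable_cutoff_green (b₁ b₂ x₂ : ℝ) (k : ℕ) (N : ℝ) :
    ∃ B : ℂ → L2 →L[ℂ] L2, Differentiable ℂ B ∧ ∀ s v, B s v =ᵐ[volume]
      (Set.Icc (-N) N).indicator fun x =>
        ∫ y, outgoingKernel b₁ b₂ x₂ k s x y * cutoff N v y := by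
  obtain ⟨FL, hFL, hFLe⟩ := isEntireFamily_jostL (b₁ := b₁) (b₂ := b₂) (x₂ := x₂) (k := k)
    (measurableSet_Icc (a := -N) (b := N)) (Metric.isBounded_Icc _ _)
  obtain ⟨FR, hFR, hFRe⟩ := isEntireFamily_jostR (b₁ := b₁) (b₂ := b₂) (x₂ := x₂) (k := k)
    (measurableSet_Icc (a := -N) (b := N)) (Metric.isBounded_Icc _ _)
  set χ : ℝ → ℂ := (Set.Icc (-N) N).indicator fun _ => 1 with hχ
  obtain ⟨C₁, hK₁⟩ := exists_isSchurKernel_window N (f₁ := χ) (g₁ := χ) (f₂ := 0) (g₂ := 0)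
    (by simp [hχ])
  obtain ⟨C₂, hK₂⟩ := exists_isSchurKernel_window N (f₁ := 0) (g₁ := 0) (f₂ := χ) (g₂ := χ)
    (by simp [hχ])
  -- Each triangular half of the kernel is a product in x and y: multiply by one Jost solution,
  -- integrate with a fixed truncated kernel, multiply by the other. The parameter s enters only
  -- through the multipliers.
  refine ⟨fun s => (mulL2 (FR s)).comp (hK₁.op.comp (mulL2 (FL s))) +
    (mulL2 (FL s)).comp (hK₂.op.comp (mulL2 (FR s))), ?_, fun s v => ?_⟩
  · have h1 : Differentiable ℂ fun s => mulL2 (FL s) := mulL2.differentiable.comp hFL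
    have h2 : Differentiable ℂ fun s => mulL2 (FR s) := mulL2.differentiable.comp hFR
    exact (h2.clm_comp ((differentiable_const _).clm_comp h1)).add
      (h1.clm_comp ((differentiable_const _).clm_comp h2))
  · set vL := mulL2 (FL s) v with hvL
    set vR := mulL2 (FR s) v with hvR
    have i1 := hK₁.ae_integrable (Lp.stronglyMeasurable vL).measurable (Lp.memLp vL)
    have i2 := hK₂.ae_integrable (Lp.stronglyMeasurable vR).measurable (Lp.memLp vR)
    change (mulL2 (FR s) (hK₁.op vL) + mulL2 (FL s) (hK₂.op vR) : L2) =ᵐ[volume] _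
    have eL : ∀ᵐ y, vL y = (Set.Icc (-N) N).indicator (jostL b₁ b₂ x₂ k s) y * v y := by
      filter_upwards [coeFn_mulL2 (FL s) v, hFLe s] with y h1 h2
      rw [hvL, h1, h2]
    have eR : ∀ᵐ y, vR y = (Set.Icc (-N) N).indicator (jostR b₁ b₂ x₂ k s) y * v y := by
      filter_upwards [coeFn_mulL2 (FR s) v, hFRe s] with y h1 h2
      rw [hvR, h1, h2]
    filter_upwards [Lp.coeFn_add (mulL2 (FR s) (hK₁.op vL)) (mulL2 (FL s) (hK₂.op vR)),
      coeFn_mulL2 (FR s) (hK₁.op vL), coeFn_mulL2 (FL s) (hK₂.op vR), hK₁.coeFn_op vL,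
      hK₂.coeFn_op vR, hFLe s, hFRe s, i1, i2] with x h1 h2 h3 h4 h5 h6 h7 h8 h9
    rw [h1, Pi.add_apply, h2, h3, h4, h5, h6, h7, ← integral_const_mul, ← integral_const_mul,
      ← integral_add (h8.const_mul _) (h9.const_mul _)]
    by_cases hx : x ∈ Set.Icc (-N) N
    · rw [Set.indicator_of_mem hx, Set.indicator_of_mem hx, Set.indicator_of_mem hx]
      refine integral_congr_ae ?_
      filter_upwards [eL, eR, cutoffFun_coeFn N v] with y g1 g2 g3
      have g3' : cutoff N v y = (Set.Icc (-N) N).indicator (fun y => v y) y := g3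
      rw [g1, g2, g3']
      unfold outgoingKernel greenKernel
      have hχx : χ x = 1 := Set.indicator_of_mem hx _
      by_cases hy : y ∈ Set.Icc (-N) N
      · have hχy : χ y = 1 := Set.indicator_of_mem hy _
        simp only [Set.indicator_of_mem hy, hχx, hχy, Pi.zero_apply]
        split_ifs <;> ring
      · simp [Set.indicator_of_notMem hy]
    · rw [Set.indicator_of_notMem hx, Set.indicator_of_notMem hx, Set.indicator_of_notMem hx]
      simp

theorem differentiable_neg_I_mul : Differentiable ℂ fun z : ℂ => -I * z := by fun_prop

theorem isCutoffResolventContinuation_of_green (hb₁ : 0 < b₁) (hb₂ : 0 < b₂) (hx₀ : 0 < x₂)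
    (hx₁ : x₂ < 1) (hk : 1 ≤ k) {N : ℝ} {B : ℂ → L2 →L[ℂ] L2} (hB : Differentiable ℂ B)
    (hBv : ∀ s v, B s v =ᵐ[volume] (Set.Icc (-N) N).indicator fun x =>
      ∫ y, outgoingKernel b₁ b₂ x₂ k s x y * cutoff N v y) :
    IsCutoffResolventContinuation b₁ b₂ x₂ k N
      fun z => (wronskian b₁ b₂ x₂ k (-I * z))⁻¹ • -B (-I * z) := by
  have hW : Differentiable ℂ fun z => wronskian b₁ b₂ x₂ k (-I * z) :=
    (differentiable_wronskian hk).comp differentiable_neg_I_mul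
  have hB' : Differentiable ℂ fun z => -B (-I * z) := (hB.comp differentiable_neg_I_mul).neg
  refine ⟨fun z _ => (hW.analyticAt z).meromorphicAt.inv.smul (hB'.analyticAt z).meromorphicAt,
    fun z hz => ?_⟩
  obtain ⟨R, hR, hRv⟩ := exists_resolvent hb₁ hb₂ hx₀ hx₁ hk hz
  refine ⟨R, hR, ?_⟩
  ext1 v
  change (wronskian b₁ b₂ x₂ k (-I * z))⁻¹ • -(B (-I * z) v) = cutoff N (R (cutoff N v))
  apply Lp.ext
  filter_upwards [Lp.coeFn_smul (wronskian b₁ b₂ x₂ k (-I * z))⁻¹ (-(B (-I * z) v)),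
    Lp.coeFn_neg (B (-I * z) v), hBv (-I * z) v, cutoffFun_coeFn N (R (cutoff N v)),
    hRv (cutoff N v)] with x h1 h2 h3 h4 h5
  have h4' : cutoff N (R (cutoff N v)) x =
    (Set.Icc (-N) N).indicator (fun y => R (cutoff N v) y) x := h4
  rw [h1, Pi.smul_apply, h2, Pi.neg_apply, h3, h4', smul_eq_mul]
  by_cases hx : x ∈ Set.Icc (-N) N
  · rw [Set.indicator_of_mem hx, Set.indicator_of_mem hx, h5]; ring
  · rw [Set.indicator_of_notMem hx, Set.indicator_of_notMem hx]; simp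

/-- The cut-off Green operator does not vanish when the window contains the medium. -/
theorem cutoff_green_ne_zero (hx₀ : 0 < x₂) (hx₁ : x₂ < 1) {N : ℝ} (hN1 : 1 ≤ N)
    (hN : rightEnd x₂ k < N) (hk : 1 ≤ k) (s : ℂ) {T : L2 →L[ℂ] L2}
    (hT : ∀ v, T v =ᵐ[volume] (Set.Icc (-N) N).indicator fun x =>
      ∫ y, outgoingKernel b₁ b₂ x₂ k s x y * cutoff N v y) : T ≠ 0 := by
  intro h0
  have hL := rightEnd_pos hx₀ hk
  -- The test function is 1/`jostL` on [-1, 0). For x right of the medium the integral then equals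
  -- `jostR` at x, a nonvanishing exponential for every s, including zeros of W.
  have hv : MemLp ((Set.Ico (-1 : ℝ) 0).indicator fun y : ℝ => exp (-s * b₁ * y)) 2 volume := by
    rw [memLp_indicator_iff_restrict measurableSet_Ico]
    have hc : Continuous fun y : ℝ => exp (-s * b₁ * y) := by fun_prop
    exact (memL2Loc_of_continuous hc (Set.Icc (-1) 0) isCompact_Icc).mono_measure
      (Measure.restrict_mono Set.Ico_subset_Icc_self le_rfl)
  have h1 := hT (hv.toLp _)
  rw [h0] at h1
  have hpos : volume (Set.Ioo (rightEnd x₂ k) N) ≠ 0 := by simp [hN]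
  obtain ⟨x, hx, hx0, hx1⟩ : ∃ x ∈ Set.Ioo (rightEnd x₂ k) N, ((0 : L2) : ℝ → ℂ) x = 0 ∧
      ((0 : L2) : ℝ → ℂ) x = (Set.Icc (-N) N).indicator (fun x =>
        ∫ y, outgoingKernel b₁ b₂ x₂ k s x y * cutoff N (hv.toLp _) y) x := by
    by_contra hcon
    push Not at hcon
    refine hpos (measure_mono_null (t := {x | ¬ (((0 : L2) : ℝ → ℂ) x = 0 ∧
      ((0 : L2) : ℝ → ℂ) x = (Set.Icc (-N) N).indicator (fun x =>
        ∫ y, outgoingKernel b₁ b₂ x₂ k s x y * cutoff N (hv.toLp _) y) x)}) ?_ ?_)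
    · intro x hx hc
      exact hcon x hx hc.1 hc.2
    · rw [← ae_iff]
      filter_upwards [h1, Lp.coeFn_zero ℂ 2 (volume : Measure ℝ)] with x g1 g2
      exact ⟨g2, g1⟩
  rw [hx0, Set.indicator_of_mem (show x ∈ Set.Icc (-N) N from ⟨by linarith [hx.1], hx.2.le⟩)] at hx1
  have e : ∫ y, outgoingKernel b₁ b₂ x₂ k s x y * cutoff N (hv.toLp _) y =
      ∫ y, (Set.Ico (-1 : ℝ) 0).indicator (fun _ => jostR b₁ b₂ x₂ k s x) y := by
    refine integral_congr_ae ?_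
    filter_upwards [cutoffFun_coeFn N (hv.toLp _), hv.coeFn_toLp] with y g1 g2
    have g1' : cutoff N (hv.toLp _) y = (Set.Icc (-N) N).indicator (fun y => hv.toLp _ y) y := g1
    rw [g1']
    by_cases hy : y ∈ Set.Ico (-1 : ℝ) 0
    · have hy' : y ∈ Set.Icc (-N) N := ⟨by linarith [hy.1], by linarith [hy.2]⟩
      rw [Set.indicator_of_mem hy', g2,
        Set.indicator_of_mem hy, Set.indicator_of_mem hy, outgoingKernel, greenKernel,
        if_pos (by linarith [hy.2, hx.1]), jostL_of_neg hx₀ hx₁ s hy.2]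
      have e1 : exp (s * b₁ * y) * exp (-s * b₁ * y) = 1 := by
        rw [← exp_add, ← exp_zero]; congr 1; ring
      linear_combination jostR b₁ b₂ x₂ k s x * e1
    · rw [Set.indicator_of_notMem hy]
      by_cases hy' : y ∈ Set.Icc (-N) N
      · rw [Set.indicator_of_mem hy', g2, Set.indicator_of_notMem hy, mul_zero]
      · rw [Set.indicator_of_notMem hy', mul_zero]
  rw [e, integral_indicator measurableSet_Ico, setIntegral_const, jostR_of_lt hx₀ hx₁ s hx.1] at hx1
  simp at hx1

/-! ### Orders of poles -/

/-- The order is minus that of f, which is positive and finite. Finiteness matters: if f vanished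
near z, so would its inverse in Lean's convention, and the order would be ⊤. -/
theorem meromorphicOrderAt_inv_smul_neg {E : Type*} [NormedAddCommGroup E] [NormedSpace ℂ E]
    {f : ℂ → ℂ} {g : ℂ → E} {z : ℂ} (hf : AnalyticAt ℂ f z) (hg : AnalyticAt ℂ g z)
    (hf0 : f z = 0) (hft : meromorphicOrderAt f z ≠ ⊤) (hg0 : g z ≠ 0) :
    meromorphicOrderAt (fun w => (f w)⁻¹ • g w) z < 0 := by
  have h1 : 0 < meromorphicOrderAt f z := by
    rw [← tendsto_zero_iff_meromorphicOrderAt_pos hf.meromorphicAt, ← hf0]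
    exact hf.continuousAt.tendsto.mono_left nhdsWithin_le_nhds
  have h2 : meromorphicOrderAt g z = 0 := by
    rw [← tendsto_ne_zero_iff_meromorphicOrderAt_eq_zero hg.meromorphicAt]
    exact ⟨g z, hg0, hg.continuousAt.tendsto.mono_left nhdsWithin_le_nhds⟩
  have h3 : meromorphicOrderAt (fun w => (f w)⁻¹ • g w) z =
      meromorphicOrderAt (f⁻¹) z + meromorphicOrderAt g z :=
    meromorphicOrderAt_smul hf.meromorphicAt.inv hg.meromorphicAt
  rw [h3, h2, add_zero, meromorphicOrderAt_inv]
  lift meromorphicOrderAt f z to ℤ using hft with n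
  norm_cast at h1 ⊢
  exact neg_lt_zero.2 h1

theorem meromorphicOrderAt_ne_top_of_entire {f : ℂ → ℂ} (hf : Differentiable ℂ f) {w : ℂ}
    (hw : f w ≠ 0) (z : ℂ) : meromorphicOrderAt f z ≠ ⊤ := by
  have hm : MeromorphicOn f Set.univ := fun z _ => (hf.analyticAt z).meromorphicAt
  refine hm.meromorphicOrderAt_ne_top_of_isPreconnected isPreconnected_univ (Set.mem_univ w)
    (Set.mem_univ z) ?_
  have : meromorphicOrderAt f w = 0 := by
    rw [← tendsto_ne_zero_iff_meromorphicOrderAt_eq_zero (hf.analyticAt w).meromorphicAt]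
    exact ⟨f w, hw, hf.continuous.continuousAt.tendsto.mono_left nhdsWithin_le_nhds⟩
  rw [this]
  exact WithTop.zero_ne_top

/-- The continuation of the cut-off resolvent is unique up to a discrete set. -/
theorem IsCutoffResolventContinuation.eventuallyEq {N : ℝ} {A A' : ℂ → L2 →L[ℂ] L2}
    (h : IsCutoffResolventContinuation b₁ b₂ x₂ k N A)
    (h' : IsCutoffResolventContinuation b₁ b₂ x₂ k N A') (z : ℂ) :
    A =ᶠ[nhdsWithin z {z}ᶜ] A' := by
  have hm : MeromorphicOn (A - A') Set.univ := h.1.sub h'.1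
  have heq : ∀ w : ℂ, 0 < w.im → (A - A') w = 0 := fun w hw => by
    obtain ⟨R, hR, hA⟩ := h.2 w hw
    obtain ⟨R', hR', hA'⟩ := h'.2 w hw
    rw [Pi.sub_apply, hA, hA', hR.unique hR', sub_self]
  -- The two continuations agree near i by uniqueness of the resolvent, and infinite order spreads
  -- over the connected plane.
  have hI : meromorphicOrderAt (A - A') I = ⊤ := by
    rw [meromorphicOrderAt_eq_top_iff]
    refine Filter.Eventually.filter_mono nhdsWithin_le_nhds ?_
    filter_upwards [(isOpen_lt continuous_const continuous_im).mem_nhds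
      (show (0 : ℝ) < I.im by simp)] with w hw
    exact heq w hw
  have hz : meromorphicOrderAt (A - A') z = ⊤ := by
    by_contra hne
    exact hm.meromorphicOrderAt_ne_top_of_isPreconnected isPreconnected_univ (Set.mem_univ z)
      (Set.mem_univ I) hne hI
  rw [meromorphicOrderAt_eq_top_iff] at hz
  filter_upwards [hz] with w hw
  exact sub_eq_zero.1 hw

/-- Every continuation agrees near z, off z itself, with the explicit quotient by W, for any N.
Hence there is no pole when W ≠ 0, and a zero of W gives a pole on the window of radius k + 1, where
the numerator is nonzero. -/
theorem mem_resonances_iff (hb₁ : 0 < b₁) (hb₂ : 0 < b₂) (hx₀ : 0 < x₂)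
    (hx₁ : x₂ < 1) (hk : 1 ≤ k) {z : ℂ} (hz : z.im < 0) :
    z ∈ resonances b₁ b₂ x₂ k ↔ detD b₁ b₂ x₂ (2 * k + 1) (-I * z) = 0 := by
  have hz0 : -I * z ≠ 0 := mul_ne_zero (neg_ne_zero.2 I_ne_zero) fun h => by simp [h] at hz
  have hWz := wronskian_ne_zero_iff (x₂ := x₂) (k := k) hb₁ hb₂ hz0
  have hW : Differentiable ℂ fun z => wronskian b₁ b₂ x₂ k (-I * z) :=
    (differentiable_wronskian hk).comp differentiable_neg_I_mul
  constructor
  · rintro ⟨-, N, A, hA, hord⟩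
    by_contra hD
    obtain ⟨B, hB, hBv⟩ := exists_differentiable_cutoff_green b₁ b₂ x₂ k N
    have hA' := isCutoffResolventContinuation_of_green hb₁ hb₂ hx₀ hx₁ hk hB hBv
    rw [meromorphicOrderAt_congr (hA.eventuallyEq hA' z)] at hord
    refine absurd hord (not_lt.2 (AnalyticAt.meromorphicOrderAt_nonneg ?_))
    exact ((hW.analyticAt z).inv (hWz.2 hD)).smul
      ((hB.comp differentiable_neg_I_mul).neg.analyticAt z)
  · intro hD
    obtain ⟨B, hB, hBv⟩ := exists_differentiable_cutoff_green b₁ b₂ x₂ k ((k : ℝ) + 1)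
    refine ⟨hz, (k : ℝ) + 1, _,
      isCutoffResolventContinuation_of_green hb₁ hb₂ hx₀ hx₁ hk hB hBv, ?_⟩
    have hW1 : wronskian b₁ b₂ x₂ k (-I * I) ≠ 0 := by
      have : -I * I = 1 := by simp
      rw [this]
      exact (wronskian_ne_zero_iff hb₁ hb₂ one_ne_zero).2
        (detD_ne_zero hb₁ hb₂ hx₀ hx₁ hk (by simp))
    refine meromorphicOrderAt_inv_smul_neg (hW.analyticAt z)
      ((hB.comp differentiable_neg_I_mul).neg.analyticAt z) ?_
      (meromorphicOrderAt_ne_top_of_entire hW hW1 z) (neg_ne_zero.2 ?_)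
    · by_contra hne
      exact hWz.1 hne hD
    · refine cutoff_green_ne_zero hx₀ hx₁ ?_ ?_ hk (-I * z) (hBv (-I * z))
      · linarith [Nat.cast_nonneg (α := ℝ) k]
      · rw [rightEnd]; linarith

end Continuation

/-! ### The reflection coefficient -/

section Reflection

variable {b₁ b₂ x₂ : ℝ} {k : ℕ}

/-- The meromorphic extension of the reflection coefficient. -/
def reflection (b₁ b₂ x₂ : ℝ) (k : ℕ) (z : ℂ) : ℂ :=
  (detD b₁ b₂ x₂ (2 * k + 1) (-I * z))⁻¹ •
    -(exp (-2 * (-I * z) * b₁ * rightEnd x₂ k) * detDtilde b₁ b₂ x₂ (2 * k + 1) (-I * z))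

theorem differentiable_reflection_num (hk : 1 ≤ k) : Differentiable ℂ fun z : ℂ =>
    -(exp (-2 * (-I * z) * b₁ * rightEnd x₂ k) * detDtilde b₁ b₂ x₂ (2 * k + 1) (-I * z)) := by
  have h := (differentiable_detD (b₁ := b₁) (b₂ := b₂) (x₂ := x₂) hk).2.comp
    differentiable_neg_I_mul
  have h' : Differentiable ℂ fun z : ℂ => exp (-2 * (-I * z) * b₁ * rightEnd x₂ k) := by fun_prop
  exact (h'.mul h).neg

theorem differentiable_reflection_den (hk : 1 ≤ k) : Differentiable ℂ fun z : ℂ =>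
    detD b₁ b₂ x₂ (2 * k + 1) (-I * z) :=
  (differentiable_detD (b₁ := b₁) (b₂ := b₂) (x₂ := x₂) hk).1.comp differentiable_neg_I_mul

theorem analyticAt_reflection (hk : 1 ≤ k) {z : ℂ}
    (hz : detD b₁ b₂ x₂ (2 * k + 1) (-I * z) ≠ 0) : AnalyticAt ℂ (reflection b₁ b₂ x₂ k) z :=
  (((differentiable_reflection_den hk).analyticAt z).inv hz).smul
    ((differentiable_reflection_num hk).analyticAt z)

theorem meromorphicOn_reflection (hk : 1 ≤ k) :
    MeromorphicOn (reflection b₁ b₂ x₂ k) Set.univ := fun z _ =>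
  ((differentiable_reflection_den hk).analyticAt z).meromorphicAt.inv.smul
    ((differentiable_reflection_num hk).analyticAt z).meromorphicAt

/-- At a zero of the denominator the numerator survives, since the two determinants never vanish
together. -/
theorem meromorphicOrderAt_reflection_neg_iff (hb₁ : 0 < b₁) (hb₂ : 0 < b₂) (hx₀ : 0 < x₂)
    (hx₁ : x₂ < 1) (hk : 1 ≤ k) (z : ℂ) :
    meromorphicOrderAt (reflection b₁ b₂ x₂ k) z < 0 ↔
      detD b₁ b₂ x₂ (2 * k + 1) (-I * z) = 0 := by
  constructor
  · intro h
    by_contra hne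
    exact absurd h (not_lt.2 (analyticAt_reflection hk hne).meromorphicOrderAt_nonneg)
  · intro h
    refine meromorphicOrderAt_inv_smul_neg ((differentiable_reflection_den hk).analyticAt z)
      ((differentiable_reflection_num hk).analyticAt z) h
      (meromorphicOrderAt_ne_top_of_entire (differentiable_reflection_den hk) (w := I)
        (detD_ne_zero hb₁ hb₂ hx₀ hx₁ hk (by simp)) z) ?_
    exact neg_ne_zero.2 (mul_ne_zero (exp_ne_zero _)
      (detDtilde_ne_zero_of_detD_eq_zero hb₁ hb₂ hk h))

/-- The exponentials `e^{cy}` and `e^{-cy}` are linearly independent on open sets. -/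
theorem exp_coeffs_eq_zero {c A B : ℂ} (hc : c ≠ 0) {U : Set ℝ} (hU : IsOpen U)
    (hne : U.Nonempty) (h : ∀ y ∈ U, A * exp (c * y) + B * exp (-c * y) = 0) :
    A = 0 ∧ B = 0 := by
  obtain ⟨y, hy⟩ := hne
  have hd := ((hasDerivAt_exp_mul c y).const_mul A).add ((hasDerivAt_exp_mul (-c) y).const_mul B)
  have h0 : HasDerivAt (fun y : ℝ => A * exp (c * y) + B * exp (-c * y)) 0 y :=
    (hasDerivAt_const y (0 : ℂ)).congr_of_eventuallyEq
      (Filter.eventuallyEq_of_mem (hU.mem_nhds hy) h)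
  have e1 := hd.unique h0
  have e2 := h y hy
  have e3 : c * (A * exp (c * y) - B * exp (-c * y)) = 0 := by linear_combination e1
  have e4 := (mul_eq_zero.1 e3).resolve_left hc
  constructor
  · have : (2 * A) * exp (c * y) = 0 := by linear_combination e2 + e4
    simpa [exp_ne_zero] using this
  · have : (2 * B) * exp (-c * y) = 0 := by linear_combination e2 - e4
    simpa [exp_ne_zero] using this

theorem IsSolution.const_mul {a : ℝ → ℝ} {s : ℂ} {ψ p : ℝ → ℂ} (h : IsSolution a s ψ p) (c : ℂ) :
    IsSolution a s (fun x => c * ψ x) fun x => c * p x :=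
  ⟨(h.left.const_mul c).congr_ae (Filter.Eventually.of_forall fun x => by ring),
    (h.right.const_mul c).congr_ae (Filter.Eventually.of_forall fun x => by ring)⟩

/-- The condition on the right kills the `jostL` component because det D_{2k+1} ≠ 0, so ψ is a
multiple of `jostR`. The unit incident amplitude fixes the multiple, and the other amplitude is ρ.
For z = 0 the two exponentials would coincide. -/
theorem isReflectionCoefficient_iff (hb₁ : 0 < b₁) (hb₂ : 0 < b₂) (hx₀ : 0 < x₂)
    (hx₁ : x₂ < 1) (hk : 1 ≤ k) {z : ℂ} (hz : 0 ≤ z.im) (hz0 : z ≠ 0) (ρ : ℂ) :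
    IsReflectionCoefficient b₁ b₂ x₂ k z ρ ↔ ρ = reflection b₁ b₂ x₂ k z := by
  set s : ℂ := -I * z with hsz
  have hs : 0 ≤ s.re := by simpa [hsz] using hz
  have hs2 : s ^ 2 = -z ^ 2 := by rw [hsz, mul_pow, neg_sq, I_sq]; ring
  have hs0 : s ≠ 0 := mul_ne_zero (neg_ne_zero.2 I_ne_zero) hz0
  have hc0 : s * b₁ ≠ 0 := mul_ne_zero hs0 (ofReal_ne_zero.2 hb₁.ne')
  have hD := detD_ne_zero hb₁ hb₂ hx₀ hx₁ hk hs
  have hW := (wronskian_ne_zero_iff (x₂ := x₂) (k := k) hb₁ hb₂ hs0).2 hD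
  have hn := rightNorm_ne_zero (k := k) hb₁ hb₂
  have hLk : rightEnd x₂ k < k := by rw [rightEnd]; linarith
  have e1 : ∀ y : ℝ, exp (I * z * b₁ * y) = exp (-(s * b₁) * y) := fun y => by
    congr 1; rw [hsz]; ring
  have e2 : ∀ y : ℝ, exp (-(I * z * b₁ * y)) = exp (s * b₁ * y) := fun y => by
    congr 1; rw [hsz]; ring
  have hE : exp (s * b₁ * rightEnd x₂ k) ≠ 0 := exp_ne_zero _
  have hEE : exp (-s * b₁ * rightEnd x₂ k) =
      exp (-2 * s * b₁ * rightEnd x₂ k) * exp (s * b₁ * rightEnd x₂ k) := by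
    rw [← exp_add]; congr 1; ring
  have hr : reflection b₁ b₂ x₂ k z = -(exp (-2 * s * b₁ * rightEnd x₂ k) *
      detDtilde b₁ b₂ x₂ (2 * k + 1) s) / detD b₁ b₂ x₂ (2 * k + 1) s := by
    rw [reflection, smul_eq_mul, ← hsz]; ring
  have solR := isSolution_jostR (k := k) hb₁ hb₂ hx₀ hx₁ s
  constructor
  · rintro ⟨ψ, w, τ, h1, h2, h3, h4⟩
    have h2' := h2.2.2.congr_ae (Filter.EventuallyEq.refl _ _) (G := fun x => s ^ 2 * ψ x)
      (Filter.Eventually.of_forall fun x => by simp only [hs2]; ring)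
    obtain ⟨Ψ, P, hΨ, hsol⟩ := exists_isSolution_of_hasWeakDeriv (coeff_ne_zero hb₁ hb₂) h1.2.2 h2'
    obtain ⟨α, β, hαβ⟩ := hsol.exists_combination (isSolution_jostL hb₁ hb₂ hx₀ hx₁ s)
      solR hW (wronskian_eq hb₁ hb₂ hx₀ hx₁ hk s)
    -- The regular representative agrees with ψ only almost everywhere; continuity upgrades this to
    -- equality on the open half-line.
    have hright : ∀ y ∈ Set.Ioi (k : ℝ), Ψ y = τ * exp (-(s * b₁) * y) := by
      refine Measure.eqOn_open_of_ae_eq (μ := volume) (f := Ψ)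
        (g := fun y => τ * exp (-(s * b₁) * y)) ?_ isOpen_Ioi hsol.left.continuous.continuousOn
        (by fun_prop)
      filter_upwards [ae_restrict_of_ae hΨ, ae_restrict_mem measurableSet_Ioi] with y g1 g2
      rw [← g1, h4 y g2, e1]
    have hleft : ∀ y ∈ Set.Iio (0 : ℝ), Ψ y = exp (-(s * b₁) * y) + ρ * exp (s * b₁ * y) := by
      refine Measure.eqOn_open_of_ae_eq (μ := volume) (f := Ψ)
        (g := fun y => exp (-(s * b₁) * y) + ρ * exp (s * b₁ * y)) ?_ isOpen_Iio
        hsol.left.continuous.continuousOn (by fun_prop)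
      filter_upwards [ae_restrict_of_ae hΨ, ae_restrict_mem measurableSet_Iio] with y g1 g2
      rw [← g1, h3 y g2, e1, e2]
    have hα : α = 0 := by
      have := (exp_coeffs_eq_zero hc0 isOpen_Ioi Set.nonempty_Ioi
        (A := α * (rightNorm b₁ b₂ k * detD b₁ b₂ x₂ (2 * k + 1) s))
        (B := β * exp (s * b₁ * rightEnd x₂ k) - τ -
          α * (rightNorm b₁ b₂ k * detDtilde b₁ b₂ x₂ (2 * k + 1) s)) fun y hy => by
        have g := hright y hy
        rw [hαβ y, jostL_of_le hk s (hLk.trans hy).le, jostR_of_lt hx₀ hx₁ s (hLk.trans hy),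
          neg_mul s] at g
        linear_combination g).1
      exact (mul_eq_zero.1 this).resolve_right (mul_ne_zero hn hD)
    obtain ⟨c1, c2⟩ := exp_coeffs_eq_zero hc0 isOpen_Iio Set.nonempty_Iio
      (A := -(β * (rightNorm b₁ b₂ k * (detDtilde b₁ b₂ x₂ (2 * k + 1) s *
        exp (-s * b₁ * rightEnd x₂ k)))) - ρ)
      (B := β * (rightNorm b₁ b₂ k * (detD b₁ b₂ x₂ (2 * k + 1) s *
        exp (s * b₁ * rightEnd x₂ k))) - 1) fun y hy => by
      have g := hleft y hy
      rw [hαβ y, hα, jostR_of_neg hk s hy] at g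
      rw [show exp (-s * b₁ * y) = exp (-(s * b₁) * y) by congr 1; ring] at g
      linear_combination g
    rw [hr, eq_div_iff hD]
    rw [hEE] at c1
    linear_combination (-detD b₁ b₂ x₂ (2 * k + 1) s) * c1 -
      detDtilde b₁ b₂ x₂ (2 * k + 1) s * exp (-2 * s * b₁ * rightEnd x₂ k) * c2
  · rintro rfl
    -- This normalizes the incident wave e^{iλb₁y} of `jostR` on the left to amplitude 1.
    set c : ℂ := (rightNorm b₁ b₂ k * (detD b₁ b₂ x₂ (2 * k + 1) s *
      exp (s * b₁ * rightEnd x₂ k)))⁻¹ with hc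
    have hsol := solR.const_mul c
    have hcoe : (fun x => (coeff b₁ b₂ x₂ k x : ℂ) *
        ((coeff b₁ b₂ x₂ k x : ℂ)⁻¹ * (c * fluxR b₁ b₂ x₂ k s x))) =
        fun x => c * fluxR b₁ b₂ x₂ k s x := by
      funext x
      rw [mul_inv_cancel_left₀ (ofReal_ne_zero.2 (coeff_ne_zero hb₁ hb₂ x))]
    refine ⟨fun x => c * jostR b₁ b₂ x₂ k s x, fun x => (coeff b₁ b₂ x₂ k x : ℂ)⁻¹ *
      (c * fluxR b₁ b₂ x₂ k s x), c * exp (s * b₁ * rightEnd x₂ k),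
      hsol.hasH1LocDeriv measurable_coeff abs_inv_coeff_le, ?_, fun y hy => ?_, fun y hy => ?_⟩
    · rw [hcoe]
      convert hsol.hasH1LocDeriv_flux using 1
      funext x
      rw [hs2]; ring
    · simp only
      rw [jostR_of_neg hk s hy, e1, e2, hr, hEE, hc,
        show exp (-s * b₁ * y) = exp (-(s * b₁) * y) by congr 1; ring]
      field_simp
      ring
    · simp only
      rw [jostR_of_lt hx₀ hx₁ s (hLk.trans hy), e1, neg_mul s, ← mul_assoc c]

/-! ### The last step of the recursion -/

theorem detD_two_mul_add_one (hk : 1 ≤ k) (s : ℂ) :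
    detD b₁ b₂ x₂ (2 * k + 1) s = exp (-s * b₁ * rightEnd x₂ k) *
      ((b₂ - b₁) * exp (-s * b₂ * rightEnd x₂ k) * detDtilde b₁ b₂ x₂ (2 * k) s -
        (b₂ + b₁) * exp (s * b₂ * rightEnd x₂ k) * detD b₁ b₂ x₂ (2 * k) s) ∧
    detDtilde b₁ b₂ x₂ (2 * k + 1) s = exp (s * b₁ * rightEnd x₂ k) *
      ((b₂ - b₁) * exp (s * b₂ * rightEnd x₂ k) * detD b₁ b₂ x₂ (2 * k) s -
        (b₂ + b₁) * exp (-s * b₂ * rightEnd x₂ k) * detDtilde b₁ b₂ x₂ (2 * k) s) := by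
  obtain ⟨m, rfl⟩ : ∃ m, k = m + 1 := ⟨k - 1, by omega⟩
  have h1 : layerB b₁ b₂ (2 * m + 3) = b₁ := layerB_two_mul_add_one (m + 1)
  have h2 : layerB b₁ b₂ (2 * m + 2) = b₂ := layerB_two_mul (m + 1)
  have h3 : layerX x₂ (2 * m + 2) = rightEnd x₂ (m + 1) := layerX_two_mul (m + 1)
  rw [show 2 * (m + 1) + 1 = 2 * m + 3 by ring, show 2 * (m + 1) = 2 * m + 2 by ring]
  constructor <;> simp only [detD, detDtilde, detPair, h1, h2, h3]

theorem detPair_two_mul_ne_zero (hb₁ : 0 < b₁) (hb₂ : 0 < b₂) (hk : 1 ≤ k) (s : ℂ) :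
    ¬ (detD b₁ b₂ x₂ (2 * k) s = 0 ∧ detDtilde b₁ b₂ x₂ (2 * k) s = 0) := by
  obtain ⟨m, rfl⟩ : ∃ m, k = m + 1 := ⟨k - 1, by omega⟩
  have h := layerPair_ne_zero (x := layerX x₂) s (layerB_pos hb₁ hb₂) (2 * m + 1)
  rwa [layerPair_succ_eq_detPair] at h

theorem Q_two_mul (s : ℂ) : Q b₁ b₂ x₂ (2 * k) s = exp (-2 * s * b₂ * rightEnd x₂ k) *
    (detDtilde b₁ b₂ x₂ (2 * k) s / detD b₁ b₂ x₂ (2 * k) s) := by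
  rw [Q, layerB_two_mul, layerX_two_mul, rightEnd]

/-- The determinants with index `2k + 1` in terms of `Q_{2k}`. -/
theorem detD_eq_Q (hb₁ : 0 < b₁) (hb₂ : 0 < b₂) (hk : 1 ≤ k) {s : ℂ}
    (hD : detD b₁ b₂ x₂ (2 * k) s ≠ 0) :
    detD b₁ b₂ x₂ (2 * k + 1) s = -((b₁ + b₂) * exp (s * b₂ * rightEnd x₂ k) *
      detD b₁ b₂ x₂ (2 * k) s * exp (-s * b₁ * rightEnd x₂ k)) *
      (1 - dCoeff b₁ b₂ * Q b₁ b₂ x₂ (2 * k) s) ∧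
    detDtilde b₁ b₂ x₂ (2 * k + 1) s = ((b₁ + b₂) * exp (s * b₂ * rightEnd x₂ k) *
      detD b₁ b₂ x₂ (2 * k) s * exp (s * b₁ * rightEnd x₂ k)) *
      (dCoeff b₁ b₂ - Q b₁ b₂ x₂ (2 * k) s) := by
  obtain ⟨h1, h2⟩ := detD_two_mul_add_one (b₁ := b₁) (b₂ := b₂) (x₂ := x₂) hk s
  have hb : (b₂ + b₁ : ℂ) ≠ 0 := by exact_mod_cast (add_pos hb₂ hb₁).ne'
  have hE : exp (-s * b₂ * rightEnd x₂ k) =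
      exp (-2 * s * b₂ * rightEnd x₂ k) * exp (s * b₂ * rightEnd x₂ k) := by
    rw [← exp_add]; congr 1; ring
  rw [h1, h2, Q_two_mul, dCoeff, hE]
  push_cast
  constructor <;> field_simp <;> ring

theorem reflection_eq (hb₁ : 0 < b₁) (hb₂ : 0 < b₂) (hk : 1 ≤ k) {z : ℂ}
    (hD : detD b₁ b₂ x₂ (2 * k) (-I * z) ≠ 0)
    (hQ : 1 - (dCoeff b₁ b₂ : ℂ) * Q b₁ b₂ x₂ (2 * k) (-I * z) ≠ 0) :
    reflection b₁ b₂ x₂ k z = -((-(dCoeff b₁ b₂ : ℂ) + Q b₁ b₂ x₂ (2 * k) (-I * z)) /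
      (1 - (dCoeff b₁ b₂ : ℂ) * Q b₁ b₂ x₂ (2 * k) (-I * z))) := by
  obtain ⟨h1, h2⟩ := detD_eq_Q hb₁ hb₂ hk hD
  rw [reflection, smul_eq_mul, h1, h2]
  have hb : (b₁ + b₂ : ℂ) ≠ 0 := by exact_mod_cast (add_pos hb₁ hb₂).ne'
  have hE1 := exp_ne_zero (-(-I * z) * b₁ * rightEnd x₂ k)
  have hE2 := exp_ne_zero ((-I * z) * b₂ * rightEnd x₂ k)
  have hE : exp (-2 * (-I * z) * b₁ * rightEnd x₂ k) * exp ((-I * z) * b₁ * rightEnd x₂ k) =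
      exp (-(-I * z) * b₁ * rightEnd x₂ k) := by
    rw [← exp_add]; congr 1; ring
  generalize Q b₁ b₂ x₂ (2 * k) (-I * z) = q at *
  generalize (dCoeff b₁ b₂ : ℂ) = d at *
  generalize detD b₁ b₂ x₂ (2 * k) (-I * z) = D at *
  generalize exp (-2 * (-I * z) * b₁ * rightEnd x₂ k) = e₁ at *
  generalize exp ((-I * z) * b₁ * rightEnd x₂ k) = e₂ at *
  generalize exp ((-I * z) * b₂ * rightEnd x₂ k) = e₃ at *
  rw [← hE] at hE1 ⊢
  obtain ⟨he₁, he₂⟩ := mul_ne_zero_iff.1 hE1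
  field_simp
  ring

/-- If det D_{2k} = 0, the last recursion step leaves only a multiple of (b₂ - b₁) det D̃_{2k},
which is nonzero for b₁ ≠ b₂. So a zero of det D_{2k+1} forces det D_{2k} ≠ 0, and the factor 1 - dQ
decides. -/
theorem detD_eq_zero_iff_Q (hb₁ : 0 < b₁) (hb₂ : 0 < b₂) (hk : 1 ≤ k) (hne : b₁ ≠ b₂) (s : ℂ) :
    detD b₁ b₂ x₂ (2 * k + 1) s = 0 ↔ detD b₁ b₂ x₂ (2 * k) s ≠ 0 ∧
      Q b₁ b₂ x₂ (2 * k) s = 1 / (dCoeff b₁ b₂ : ℂ) := by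
  have hsub : (b₂ - b₁ : ℂ) ≠ 0 := by exact_mod_cast sub_ne_zero.2 hne.symm
  have hb : (b₁ + b₂ : ℂ) ≠ 0 := by exact_mod_cast (add_pos hb₁ hb₂).ne'
  have hd : (dCoeff b₁ b₂ : ℂ) ≠ 0 := ofReal_ne_zero.2
    (div_ne_zero (sub_ne_zero.2 hne.symm) (add_pos hb₂ hb₁).ne')
  have key : detD b₁ b₂ x₂ (2 * k) s ≠ 0 → (detD b₁ b₂ x₂ (2 * k + 1) s = 0 ↔
      Q b₁ b₂ x₂ (2 * k) s = 1 / (dCoeff b₁ b₂ : ℂ)) := fun hD => by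
    have h : -((b₁ + b₂) * exp (s * b₂ * rightEnd x₂ k) *
        detD b₁ b₂ x₂ (2 * k) s * exp (-s * b₁ * rightEnd x₂ k)) ≠ 0 :=
      neg_ne_zero.2 (mul_ne_zero (mul_ne_zero (mul_ne_zero hb (exp_ne_zero _)) hD) (exp_ne_zero _))
    rw [(detD_eq_Q hb₁ hb₂ hk hD).1, mul_eq_zero, or_iff_right h, sub_eq_zero, eq_div_iff hd,
      mul_comm, eq_comm]
  refine ⟨fun h => ?_, fun h => (key h.1).2 h.2⟩
  have hD : detD b₁ b₂ x₂ (2 * k) s ≠ 0 := fun hD => by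
    refine detPair_two_mul_ne_zero (x₂ := x₂) hb₁ hb₂ hk s ⟨hD, ?_⟩
    rw [(detD_two_mul_add_one hk s).1, hD] at h
    simpa [exp_ne_zero, hsub] using h
  exact ⟨hD, (key hD).1 h⟩

end Reflection

end FinitePeriodic

end

theorem proposition5p2 (b₁ b₂ x₂ : ℝ) (hb₁ : 0 < b₁) (hb₂ : 0 < b₂) (hx₀ : 0 < x₂) (hx₁ : x₂ < 1)
    (k : ℕ) (hk : 1 ≤ k) :
    -- the resolvent of `P_k` has a meromorphic continuation, so that `Res(P_k)` is well defined
    (∀ N : ℝ, ∃ A : ℂ → FinitePeriodic.L2 →L[ℂ] FinitePeriodic.L2,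
      FinitePeriodic.IsCutoffResolventContinuation b₁ b₂ x₂ k N A) ∧
    -- `r` is the meromorphic extension of the reflection coefficient
    ∃ r : ℂ → ℂ, MeromorphicOn r Set.univ ∧
      (∀ z : ℂ, 0 ≤ z.im → z ≠ 0 → ∀ ρ : ℂ,
        FinitePeriodic.IsReflectionCoefficient b₁ b₂ x₂ k z ρ ↔ ρ = r z) ∧
      (∀ z : ℂ, 0 ≤ z.im → AnalyticAt ℂ r z) ∧
      -- its poles in the lower half-plane are exactly the resonances
      (∀ z : ℂ, z.im < 0 →
        (meromorphicOrderAt r z < 0 ↔ z ∈ FinitePeriodic.resonances b₁ b₂ x₂ k) ∧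
        (z ∉ FinitePeriodic.resonances b₁ b₂ x₂ k → AnalyticAt ℂ r z) ∧
        (z ∈ FinitePeriodic.resonances b₁ b₂ x₂ k ↔
          FinitePeriodic.detD b₁ b₂ x₂ (2 * k + 1) (-Complex.I * z) = 0) ∧
        (b₁ ≠ b₂ →
          (z ∈ FinitePeriodic.resonances b₁ b₂ x₂ k ↔
            FinitePeriodic.detD b₁ b₂ x₂ (2 * k) (-Complex.I * z) ≠ 0 ∧
            FinitePeriodic.Q b₁ b₂ x₂ (2 * k) (-Complex.I * z) =
              1 / (FinitePeriodic.dCoeff b₁ b₂ : ℂ)))) ∧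
      -- the linear fractional formula for `r`, wherever its right-hand side is defined
      (∀ z : ℂ, FinitePeriodic.detD b₁ b₂ x₂ (2 * k) (-Complex.I * z) ≠ 0 →
        1 - (FinitePeriodic.dCoeff b₁ b₂ : ℂ) *
          FinitePeriodic.Q b₁ b₂ x₂ (2 * k) (-Complex.I * z) ≠ 0 →
        r z = -((-(FinitePeriodic.dCoeff b₁ b₂ : ℂ) +
            FinitePeriodic.Q b₁ b₂ x₂ (2 * k) (-Complex.I * z)) /
          (1 - (FinitePeriodic.dCoeff b₁ b₂ : ℂ) *
            FinitePeriodic.Q b₁ b₂ x₂ (2 * k) (-Complex.I * z)))) := by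
  refine ⟨fun N => ?_, FinitePeriodic.reflection b₁ b₂ x₂ k,
    FinitePeriodic.meromorphicOn_reflection hk, fun z hz hz0 ρ =>
      FinitePeriodic.isReflectionCoefficient_iff hb₁ hb₂ hx₀ hx₁ hk hz hz0 ρ, fun z hz =>
      -- The point z = 0 needs no separate treatment: det D_{2k+1} is nonzero on all of Re s ≥ 0,
      -- and unlike W it carries no factor s.
      FinitePeriodic.analyticAt_reflection hk
        (FinitePeriodic.detD_ne_zero hb₁ hb₂ hx₀ hx₁ hk (by simpa using hz)), fun z hz => ?_,
      fun z hD hQ => FinitePeriodic.reflection_eq hb₁ hb₂ hk hD hQ⟩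
  · obtain ⟨B, hB, hBv⟩ := FinitePeriodic.exists_differentiable_cutoff_green b₁ b₂ x₂ k N
    exact ⟨_, FinitePeriodic.isCutoffResolventContinuation_of_green hb₁ hb₂ hx₀ hx₁ hk hB hBv⟩
  · have hres := FinitePeriodic.mem_resonances_iff hb₁ hb₂ hx₀ hx₁ hk hz
    refine ⟨?_, fun h => FinitePeriodic.analyticAt_reflection hk fun h0 => h (hres.2 h0), hres,
      fun hne => ?_⟩
    · rw [hres, FinitePeriodic.meromorphicOrderAt_reflection_neg_iff hb₁ hb₂ hx₀ hx₁ hk]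
    · rw [hres, FinitePeriodic.detD_eq_zero_iff_Q hb₁ hb₂ hk hne]
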